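/- **Setting.** Let $(Y,\mathbf X)$ be a random pair with $\mathbf X\in\mathbb R^p$ and $Y\in\{1,\dots,h\}$, where $\mathbf X$ has finite fourth moments, $\boldsymbol\Sigma=\mathrm{Var}(\mathbf X)$ is positive definite and $f_y=\Pr(Y=y)>0$ for every $y$. Let $(Y_i,\mathbf X_i)$, $i=1,2,\dots$, be i.i.d. copies of $(Y,\mathbf X)$. For a symmetric positive definite matrix $A$, $A^{-1/2}$ denotes the symmetric positive definite square root of $A^{-1}$, and $P_{\mathcal S}$ denotes the orthogonal projection onto a subspace $\mathcal S\subseteq\mathbb R^p$. Put $\mathbf Z=\boldsymbol\Sigma^{-1/2}(\mathbf X-\mathrm E\mathbf X)$. A subspace $\mathcal S$ is a dimension reduction subspace if $Y$ and $\mathbf Z$ are conditionally independent given $P_{\mathcal S}\mathbf Z$; assume that the intersection $\mathcal S_{Y|\mathbf Z}$ of all such subspaces (the central subspace) is itself a dimension reduction subspace. Let $\boldsymbol\alpha_x$ be a $p\times r$ matrix of rank $r$, let $\boldsymbol\alpha=\boldsymbol\Sigma^{-1/2}\boldsymbol\alpha_x(\boldsymbol\alpha_x^T\boldsymbol\Sigma^{-1}\boldsymbol\alpha_x)^{-1/2}$,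 and let $\mathcal H=\mathrm{Span}(\boldsymbol\Sigma^{-1/2}\boldsymbol\alpha_x)=\mathrm{Span}(\boldsymbol\alpha)$. Let $J_y$ be the indicator of $\{Y=y\}$, let $\boldsymbol\varepsilon\in\mathbb R^h$ have the entries $\varepsilon_y=J_y-f_y-\boldsymbol\beta_y^T(\mathbf X-\mathrm E\mathbf X)$ with $\boldsymbol\beta_y=\boldsymbol\Sigma^{-1}\mathrm{Cov}(\mathbf X,J_y)$, and let $\mathbf D_g=\mathrm{diag}(\sqrt{f_1},\dots,\sqrt{f_h})$. From the first $n$ observations form the sample mean $\bar{\mathbf X}$, the sample covariance matrix $\hat{\boldsymbol\Sigma}$ (with divisor $n$), $\hat{\mathbf Z}_i=\hat{\boldsymbol\Sigma}^{-1/2}(\mathbf X_i-\bar{\mathbf X})$, the number $n_y$ of indices $i\le n$ with $Y_i=y$, the mean $\bar{\mathbf Z}_y$ of the $\hat{\mathbf Z}_i$ with $Y_i=y$, the $p\times h$ matrix $\mathbb Z_n$ with columns $\sqrt{n_y/n}\,\bar{\mathbf Z}_y$, the matrix $\widehat{\mathbf M}=\sum_y (n_y/n)\bar{\mathbf Z}_y\bar{\mathbf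 Z}_y^T$, $\hat{\boldsymbol\alpha}=\hat{\boldsymbol\Sigma}^{-1/2}\boldsymbol\alpha_x(\boldsymbol\alpha_x^T\hat{\boldsymbol\Sigma}^{-1}\boldsymbol\alpha_x)^{-1/2}$ and $\hat{\mathcal H}=\mathrm{Span}(\hat{\boldsymbol\Sigma}^{-1/2}\boldsymbol\alpha_x)$ (with the convention $\hat{\boldsymbol\Sigma}^{-1}=\hat{\boldsymbol\Sigma}^{-1/2}=0$ if $\hat{\boldsymbol\Sigma}$ is singular, and $\bar{\mathbf Z}_y=0$ if $n_y=0$). The marginal coordinate statistic is $T_n(\mathcal H)=n\,\mathrm{trace}(P_{\hat{\mathcal H}}\widehat{\mathbf M}P_{\hat{\mathcal H}})$. **Theorem 1.** Assume the linearity condition $\mathrm E(\mathbf Z\mid P_{\mathcal S_{Y|\mathbf Z}}\mathbf Z)=P_{\mathcal S_{Y|\mathbf Z}}\mathbf Z$ (almost surely) and the coordinate hypothesis $P_{\mathcal H}\mathcal S_{Y|\mathbf Z}=\{0\}$. Then the expectation $$\boldsymbol\Omega_{\mathcal H}=\mathrm E\bigl(\mathbf D_g^{-1}\boldsymbol\varepsilon\boldsymbol\varepsilon^T\mathbf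 D_g^{-1}\otimes\boldsymbol\alpha^T\mathbf Z\mathbf Z^T\boldsymbol\alpha\bigr)$$ exists and is positive semidefinite, and as $n\to\infty$ the vector $\sqrt n\,\mathrm{vec}(\hat{\boldsymbol\alpha}^T\mathbb Z_n)$, where $\mathrm{vec}$ stacks columns, converges in distribution to a normal random vector with mean $0$ and covariance matrix $\boldsymbol\Omega_{\mathcal H}$. Consequently $$T_n(\mathcal H)\xrightarrow{\ \mathcal L\ }\sum_{i=1}^{hr}\omega_i\chi_i^2(1),$$ where $\omega_1\ge\dots\ge\omega_{hr}$ are the eigenvalues of $\boldsymbol\Omega_{\mathcal H}$ (with multiplicity) and $\chi^2_1(1),\dots,\chi^2_{hr}(1)$ are independent chi-squared random variables with one degree of freedom. -/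

import Mathlib

open MeasureTheory ProbabilityTheory Matrix Filter Topology
open scoped MatrixOrder Kronecker

namespace CoordTest

noncomputable section

/-- The space of observations `(x, y)`: a predictor vector `x ∈ ℝᵖ` and a slice `y` out of `h`. -/
abbrev Obs (p h : ℕ) : Type := EuclideanSpace ℝ (Fin p) × Fin h

/-- `A^{-1/2}`: the positive semidefinite square root of `A⁻¹`.
(For singular `A` Mathlib has `A⁻¹ = 0`, hence `A^{-1/2} = 0`.) -/
def invSqrt {m : ℕ} (A : Matrix (Fin m) (Fin m) ℝ) : Matrix (Fin m) (Fin m) ℝ :=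
  CFC.sqrt A⁻¹

/-- The span in `ℝᵖ` of the columns of a `p × r` matrix. -/
def colSpan {p r : ℕ} (A : Matrix (Fin p) (Fin r) ℝ) : Submodule ℝ (EuclideanSpace ℝ (Fin p)) :=
  LinearMap.range (Matrix.toEuclideanLin A)

/-- The matrix of the orthogonal projection onto `S`. -/
def projMatrix {p : ℕ} (S : Submodule ℝ (EuclideanSpace ℝ (Fin p))) :
    Matrix (Fin p) (Fin p) ℝ :=
  Matrix.toEuclideanLin.symm S.starProjection.toLinearMap

/-- The orthonormalized basis `S^{-1/2} αₓ (αₓᵀ S⁻¹ αₓ)^{-1/2}` of `Span(S^{-1/2} αₓ)`; with the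
population covariance for `S` this is `α`, with the sample covariance it is `α̂`. -/
def orthoBasis {p r : ℕ} (S : Matrix (Fin p) (Fin p) ℝ) (αx : Matrix (Fin p) (Fin r) ℝ) :
    Matrix (Fin p) (Fin r) ℝ :=
  invSqrt S * αx * invSqrt (αxᵀ * S⁻¹ * αx)

/-- The subspace `Span(S^{-1/2} αₓ)` that specifies the coordinate hypothesis; with the population
covariance for `S` this is `𝓗`, with the sample covariance it is its estimate. -/
def hypSubspace {p r : ℕ} (S : Matrix (Fin p) (Fin p) ℝ) (αx : Matrix (Fin p) (Fin r) ℝ) :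
    Submodule ℝ (EuclideanSpace ℝ (Fin p)) :=
  colSpan (invSqrt S * αx)

/-! ### Population quantities; `ν` is the joint law of `(X, Y)` -/

section Population

variable {p h r : ℕ} (ν : Measure (Obs p h))

/-- `E(X)`. -/
def popMean : EuclideanSpace ℝ (Fin p) := ∫ z, z.1 ∂ν

/-- `Σ = Var(X)`. -/
def popCov : Matrix (Fin p) (Fin p) ℝ :=
  Matrix.of fun i j => cov[fun z : Obs p h => z.1 i, fun z : Obs p h => z.1 j; ν]

/-- The standardized predictor `Z = Σ^{-1/2} (X - E(X))`, as a function of the observation. -/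
def stdPred (z : Obs p h) : EuclideanSpace ℝ (Fin p) :=
  Matrix.toEuclideanLin (invSqrt (popCov ν)) (z.1 - popMean ν)

lemma measurable_stdPred : Measurable (stdPred ν) :=
  (Matrix.toEuclideanLin (invSqrt (popCov ν))).toContinuousLinearMap.continuous.measurable.comp
    (measurable_fst.sub_const _)

/-- The σ-algebra generated by `P_S Z`. -/
abbrev projSigma (S : Submodule ℝ (EuclideanSpace ℝ (Fin p))) : MeasurableSpace (Obs p h) :=
  MeasurableSpace.comap (fun z => S.starProjection (stdPred ν z)) inferInstance

lemma projSigma_le (S : Submodule ℝ (EuclideanSpace ℝ (Fin p))) :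
    projSigma ν S ≤ (inferInstance : MeasurableSpace (Obs p h)) :=
  (S.starProjection.continuous.measurable.comp (measurable_stdPred ν)).comap_le

/-- `S` is a dimension reduction subspace: `Y` and `Z` are independent given `P_S Z`. -/
def IsDimReduction [IsFiniteMeasure ν] (S : Submodule ℝ (EuclideanSpace ℝ (Fin p))) : Prop :=
  CondIndepFun (projSigma ν S) (projSigma_le ν S) (fun z : Obs p h => z.2) (stdPred ν) ν

/-- The intersection of all dimension reduction subspaces. -/
def centralSubspace [IsFiniteMeasure ν] : Submodule ℝ (EuclideanSpace ℝ (Fin p)) :=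
  sInf {S | IsDimReduction ν S}

/-- The central subspace exists: the intersection of all dimension reduction subspaces is itself
a dimension reduction subspace. -/
def CentralSubspaceExists [IsFiniteMeasure ν] : Prop :=
  IsDimReduction ν (centralSubspace ν)

/-- Linearity condition: `E(Z | P_S Z) = P_S Z` for the central subspace `S`. -/
def LinearityCondition [IsFiniteMeasure ν] : Prop :=
  ν[stdPred ν | projSigma ν (centralSubspace ν)]
    =ᵐ[ν] fun z => (centralSubspace ν).starProjection (stdPred ν z)

/-- Coordinate hypothesis: `P_𝓗` maps the central subspace to the origin. -/
def CoordinateHypothesis [IsFiniteMeasure ν] (αx : Matrix (Fin p) (Fin r) ℝ) : Prop :=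
  (centralSubspace ν).map (hypSubspace (popCov ν) αx).starProjection.toLinearMap = ⊥

/-- `f_y = P(Y = y)`. -/
def sliceProb (y : Fin h) : ℝ := ν.real {z | z.2 = y}

/-- The indicator `J_y` of slice `y`. -/
def sliceInd (y : Fin h) (z : Obs p h) : ℝ := if z.2 = y then 1 else 0

/-- `β_y = Σ⁻¹ Cov(X, J_y)`. -/
def olsCoef (y : Fin h) : Fin p → ℝ :=
  (popCov ν)⁻¹ *ᵥ fun k => cov[fun z : Obs p h => z.1 k, sliceInd y; ν]

/-- `ε`, with entries `ε_y = J_y - f_y - β_yᵀ (X - E(X))`. -/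
def olsResid (z : Obs p h) : Fin h → ℝ := fun y =>
  sliceInd y z - sliceProb ν y - olsCoef ν y ⬝ᵥ (z.1 - popMean ν).ofLp

/-- `D_g`, the diagonal matrix with entries `g_y = √f_y`. -/
def Dg : Matrix (Fin h) (Fin h) ℝ := Matrix.diagonal fun y => √(sliceProb ν y)

/-- The random matrix `D_g⁻¹ ε εᵀ D_g⁻¹ ⊗ αᵀ Z Zᵀ α`. -/
def omegaIntegrand (αx : Matrix (Fin p) (Fin r) ℝ) (z : Obs p h) :
    Matrix (Fin h × Fin r) (Fin h × Fin r) ℝ :=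
  ((Dg ν)⁻¹ * vecMulVec (olsResid ν z) (olsResid ν z) * (Dg ν)⁻¹) ⊗ₖ
    ((orthoBasis (popCov ν) αx)ᵀ * vecMulVec (stdPred ν z).ofLp (stdPred ν z).ofLp
      * orthoBasis (popCov ν) αx)

/-- `Ω_𝓗`, the entrywise expectation of `D_g⁻¹ ε εᵀ D_g⁻¹ ⊗ αᵀ Z Zᵀ α`. -/
def omegaH (αx : Matrix (Fin p) (Fin r) ℝ) : Matrix (Fin h × Fin r) (Fin h × Fin r) ℝ :=
  Matrix.of fun a b => ∫ z, omegaIntegrand ν αx z a b ∂ν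

end Population

/-! ### Sample quantities; the sample of size `n` is `s 0, …, s (n - 1)` -/

section Sample

variable {p h r : ℕ} (s : ℕ → Obs p h) (n : ℕ)

/-- The sample mean of the predictors. -/
def sampleMean : EuclideanSpace ℝ (Fin p) := (n : ℝ)⁻¹ • ∑ i ∈ Finset.range n, (s i).1

/-- The sample covariance matrix (with divisor `n`). -/
def sampleCov : Matrix (Fin p) (Fin p) ℝ :=
  (n : ℝ)⁻¹ • ∑ i ∈ Finset.range n,
    vecMulVec ((s i).1 - sampleMean s n).ofLp ((s i).1 - sampleMean s n).ofLp

/-- The sample standardized predictors. -/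
def sampleStd (i : ℕ) : EuclideanSpace ℝ (Fin p) :=
  Matrix.toEuclideanLin (invSqrt (sampleCov s n)) ((s i).1 - sampleMean s n)

/-- `n_y`, the number of observations in slice `y`. -/
def sliceCount (y : Fin h) : ℕ := {i ∈ Finset.range n | (s i).2 = y}.card

/-- `n_y / n`. -/
def sampleProb (y : Fin h) : ℝ := (sliceCount s n y : ℝ) / n

/-- The mean of the sample standardized predictors over slice `y` (zero for an empty slice). -/
def sliceMean (y : Fin h) : EuclideanSpace ℝ (Fin p) :=
  (sliceCount s n y : ℝ)⁻¹ • ∑ i ∈ Finset.range n with (s i).2 = y, sampleStd s n i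

/-- The `p × h` matrix `ℤₙ` whose `y`th column is `√(n_y / n)` times the mean of slice `y`. -/
def Zn : Matrix (Fin p) (Fin h) ℝ :=
  Matrix.of fun k y => √(sampleProb s n y) * sliceMean s n y k

/-- The sample covariance matrix of the slice means. -/
def Mhat : Matrix (Fin p) (Fin p) ℝ :=
  ∑ y, sampleProb s n y • vecMulVec (sliceMean s n y).ofLp (sliceMean s n y).ofLp

/-- `√n vec(α̂ᵀ ℤₙ)`; `vec` stacks the columns, so the entry `(y, k)` is entry `k` of column `y`. -/
def coordVector (αx : Matrix (Fin p) (Fin r) ℝ) : EuclideanSpace ℝ (Fin h × Fin r) :=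
  WithLp.toLp 2 (√(n : ℝ) • ((orthoBasis (sampleCov s n) αx)ᵀ * Zn s n).vec)

/-- The marginal coordinate statistic `Tₙ(𝓗) = n trace(P M̂ P)`, where `P` is the orthogonal
projection onto the estimated subspace. -/
def coordStat (αx : Matrix (Fin p) (Fin r) ℝ) : ℝ :=
  n * (projMatrix (hypSubspace (sampleCov s n) αx) * Mhat s n
    * projMatrix (hypSubspace (sampleCov s n) αx)).trace

end Sample

/-- The `χ²(1)` distribution: the law of the square of a standard normal variable. -/
def chiSqOne : Measure ℝ := (gaussianReal 0 1).map fun x => x ^ 2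

instance : IsProbabilityMeasure chiSqOne :=
  Measure.isProbabilityMeasure_map (by fun_prop)

end

end CoordTest

open CoordTest

/-! The limit law rests on an exact finite-sample identity. Let B(S) = (αₓᵀS⁻¹αₓ)^{-1/2} αₓᵀS⁻¹
(`scoreMatrix`). Substituting J_y = f_y + β_yᵀ(X - EX) + ε_y into the centred slice sums splits them
into n Σ̂ β_y plus residual sums. Applying B(Σ̂) to Σ̂ β_y cancels Σ̂ and leaves a multiple of
αₓᵀβ_y, which vanishes under the hypotheses (`transpose_mulVec_olsCoef_eq_zero`). Indeed, a vector u
of 𝓗 is orthogonal to the central subspace, so linearity gives E(uᵀZ | P_S Z) = 0, and conditional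
independence then gives E(J_y uᵀZ) = 0; for u a column of Σ^{-1/2}αₓ this is an entry of αₓᵀβ_y.

Hence √n vec(α̂ᵀℤₙ) equals, without remainder, a random matrix times the normalized sum of the
i.i.d. vectors with entries ε_y(X - EX) and ε_y (`coordVector_eq`). These are centred by the normal
equations of least squares and square integrable by the fourth moments. The matrix converges almost
surely, so the central limit theorem and Slutsky's theorem give a normal limit, with covariance Ω by
`omegaIntegrand_eq`.

Finally Tₙ is the squared norm of this vector (`coordStat_eq_norm_sq`), and the squared norm of a
Gaussian vector becomes a weighted χ² sum in an eigenbasis of its covariance. -/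

namespace CoordTest

/-! ### Multivariate central limit theorem and Slutsky's theorem. -/

section CentralLimit

/-- Convergence in distribution sees only the law of the limit, so the variable representing it, and
its probability space, may be exchanged. -/
lemma tendstoInDistribution_of_map_eq {Ω Ω' Ω'' E : Type*} [MeasurableSpace Ω]
    [MeasurableSpace Ω'] [MeasurableSpace Ω''] [MeasurableSpace E] [TopologicalSpace E]
    [OpensMeasurableSpace E] {P : Measure Ω} {P' : Measure Ω'} {P'' : Measure Ω''}
    [IsProbabilityMeasure P] [IsProbabilityMeasure P'] [IsProbabilityMeasure P'']
    {X : ℕ → Ω → E} {Z : Ω' → E} {W : Ω'' → E}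
    (h : TendstoInDistribution X atTop Z (fun _ => P) P') (hW : AEMeasurable W P'')
    (heq : P'.map Z = P''.map W) :
    TendstoInDistribution X atTop W (fun _ => P) P'' := by
  refine ⟨h.forall_aemeasurable, hW, ?_⟩
  have h1 := h.tendsto
  have h2 : (⟨P'.map Z, Measure.isProbabilityMeasure_map h.aemeasurable_limit⟩ :
      ProbabilityMeasure E) = ⟨P''.map W, Measure.isProbabilityMeasure_map hW⟩ := Subtype.ext heq
  rwa [h2] at h1

variable {ι κ Ω : Type*} [Fintype ι] [Fintype κ]
  [MeasurableSpace Ω] {P : Measure Ω}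

lemma memLp_apply {X : Ω → EuclideanSpace ℝ ι} {q : ENNReal} (hX : MemLp X q P) (a : ι) :
    MemLp (fun ω => X ω a) q P :=
  (EuclideanSpace.proj (𝕜 := ℝ) a : EuclideanSpace ℝ ι →L[ℝ] ℝ).comp_memLp' hX

/-- A matrix of second moments represents the second moments of linear functionals. -/
lemma dotProduct_mulVec_eq_integral {X : Ω → EuclideanSpace ℝ ι} (hX : MemLp X 2 P)
    {S : Matrix ι ι ℝ} (hS : ∀ a b, S a b = ∫ ω, X ω a * X ω b ∂P) (x : ι → ℝ) :
    x ⬝ᵥ S *ᵥ x = ∫ ω, (x ⬝ᵥ (X ω).ofLp) ^ 2 ∂P := by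
  have hint (a b : ι) : Integrable (fun ω => X ω a * X ω b) P :=
    (memLp_apply hX a).integrable_mul (memLp_apply hX b)
  have h1 (ω : Ω) : (x ⬝ᵥ (X ω).ofLp) ^ 2 = ∑ a, ∑ b, x a * x b * (X ω a * X ω b) := by
    rw [sq, dotProduct, Finset.sum_mul_sum]
    exact Finset.sum_congr rfl fun a _ => Finset.sum_congr rfl fun b _ => by ring
  simp_rw [h1]
  rw [integral_finsetSum _ fun a _ => integrable_finsetSum _ fun b _ => (hint a b).const_mul _]
  refine Finset.sum_congr rfl fun a _ => ?_
  rw [integral_finsetSum _ fun b _ => (hint a b).const_mul _, mulVec, dotProduct, Finset.mul_sum]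
  refine Finset.sum_congr rfl fun b _ => ?_
  rw [integral_const_mul, hS]
  ring

lemma posSemidef_of_eq_integral {X : Ω → EuclideanSpace ℝ ι} (hX : MemLp X 2 P)
    {S : Matrix ι ι ℝ} (hS : ∀ a b, S a b = ∫ ω, X ω a * X ω b ∂P) : S.PosSemidef := by
  refine PosSemidef.of_dotProduct_mulVec_nonneg ?_ fun x => ?_
  · ext a b
    simp [hS, mul_comm]
  · rw [star_trivial, dotProduct_mulVec_eq_integral hX hS]
    exact integral_nonneg fun ω => sq_nonneg _

lemma aemeasurable_inv_sqrt_smul_sum {X : ℕ → Ω → EuclideanSpace ℝ ι}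
    (hX : ∀ k, AEMeasurable (X k) P) (n : ℕ) :
    AEMeasurable (fun ω => (√(n : ℝ))⁻¹ • ∑ k ∈ Finset.range n, X k ω) P := by
  have h : AEMeasurable (fun ω => ∑ k ∈ Finset.range n, X k ω) P :=
    Finset.aemeasurable_fun_sum _ fun k _ => hX k
  fun_prop

/-- The multivariate central limit theorem for centred vectors. -/
theorem tendstoInDistribution_inv_sqrt_smul_sum [DecidableEq ι] [IsProbabilityMeasure P]
    {X : ℕ → Ω → EuclideanSpace ℝ ι} (hX : MemLp (X 0) 2 P) (h0 : P[X 0] = 0)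
    (hindep : iIndepFun X P) (hident : ∀ i, IdentDistrib (X i) (X 0) P P)
    {S : Matrix ι ι ℝ} (hS : ∀ a b, S a b = ∫ ω, X 0 ω a * X 0 ω b ∂P) :
    TendstoInDistribution (fun (n : ℕ) ω => (√(n : ℝ))⁻¹ • ∑ k ∈ Finset.range n, X k ω) atTop id
      (fun _ => P) (multivariateGaussian 0 S) where
  forall_aemeasurable n :=
    aemeasurable_inv_sqrt_smul_sum (fun k => (hident k).aemeasurable_fst) n
  tendsto := by
    have hpsd := posSemidef_of_eq_integral hX hS
    refine ProbabilityMeasure.tendsto_iff_tendsto_charFun.2 fun t => ?_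
    have hmt : Measurable fun x : EuclideanSpace ℝ ι => inner ℝ t x := by fun_prop
    have hXt : MemLp (fun ω => inner ℝ t (X 0 ω)) 2 P := hX.const_inner t
    have hmean : ∫ ω, inner ℝ t (X 0 ω) ∂P = 0 := by
      rw [integral_inner (hX.integrable one_le_two), h0, inner_zero_right]
    have hvar : Var[fun ω => inner ℝ t (X 0 ω); P] = t.ofLp ⬝ᵥ S *ᵥ t.ofLp := by
      rw [variance_of_integral_eq_zero hXt.aestronglyMeasurable.aemeasurable hmean,
        dotProduct_mulVec_eq_integral hX hS]
      refine integral_congr_ae (.of_forall fun ω => ?_)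
      simp [PiLp.inner_apply, dotProduct, mul_comm]
    have hclt := tendstoInDistribution_inv_sqrt_mul_sum_sub
      (X := fun i ω => inner ℝ t (X i ω)) (P := P) (Y := id)
      (P' := gaussianReal 0 Var[fun ω => inner ℝ t (X 0 ω); P].toNNReal)
      HasLaw.id hXt (hindep.comp (fun _ x => inner ℝ t x) fun _ => hmt)
      (fun i => (hident i).comp hmt)
    -- Cramér–Wold: the characteristic function of the vector at t is that of its inner product with
    -- t, evaluated at 1.
    have := ProbabilityMeasure.tendsto_iff_tendsto_charFun.1 hclt.tendsto 1
    simp only [ProbabilityMeasure.coe_mk, Measure.map_id, charFun_gaussianReal, hvar] at this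
    rw [ProbabilityMeasure.coe_mk, Measure.map_id, charFun_multivariateGaussian hpsd]
    have hnn : 0 ≤ t.ofLp ⬝ᵥ S *ᵥ t.ofLp := by
      simpa using hpsd.dotProduct_mulVec_nonneg t.ofLp
    convert this using 2 with n
    · rw [ProbabilityMeasure.coe_mk, charFun_apply, charFun_apply_real,
        integral_map (aemeasurable_inv_sqrt_smul_sum
          (fun k => (hident k).aemeasurable_fst) n) (by fun_prop),
        integral_map (by
          refine ((Finset.aemeasurable_fun_sum _ fun k _ =>
            hmt.comp_aemeasurable (hident k).aemeasurable_fst).sub_const _).const_mul _)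
          (by fun_prop)]
      refine integral_congr_ae (.of_forall fun ω => ?_)
      simp only [hmean, real_inner_smul_right, inner_sum, mul_zero, sub_zero,
        Complex.ofReal_one, one_mul, real_inner_comm]
    · rw [Real.coe_toNNReal _ hnn]
      simp

/-- Slutsky's theorem for random matrices applied to normalized sums of centred vectors. -/
theorem tendstoInDistribution_mulVec_inv_sqrt_smul_sum [DecidableEq ι] [DecidableEq κ]
    [IsProbabilityMeasure P]
    {X : ℕ → Ω → EuclideanSpace ℝ ι} (hX : MemLp (X 0) 2 P) (h0 : P[X 0] = 0)
    (hindep : iIndepFun X P) (hident : ∀ i, IdentDistrib (X i) (X 0) P P)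
    {L : ℕ → Ω → Matrix κ ι ℝ} {A : Matrix κ ι ℝ}
    (hLmeas : ∀ n a b, AEMeasurable (fun ω => L n ω a b) P)
    (hL : ∀ᵐ ω ∂P, Tendsto (fun n => L n ω) atTop (𝓝 A))
    {S : Matrix κ κ ℝ}
    (hS : ∀ a b, S a b = ∫ ω, (A *ᵥ (X 0 ω).ofLp) a * (A *ᵥ (X 0 ω).ofLp) b ∂P) :
    TendstoInDistribution (fun (n : ℕ) ω => (WithLp.toLp 2
      (L n ω *ᵥ ((√(n : ℝ))⁻¹ • ∑ k ∈ Finset.range n, X k ω).ofLp) : EuclideanSpace ℝ κ)) atTop id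
      (fun _ => P) (multivariateGaussian 0 S) := by
  set Γ : Matrix ι ι ℝ := Matrix.of fun a b => ∫ ω, X 0 ω a * X 0 ω b ∂P with hΓ
  have hW := tendstoInDistribution_inv_sqrt_smul_sum hX h0 hindep hident (S := Γ) fun _ _ => rfl
  have hLm (n : ℕ) : AEMeasurable (fun ω => (fun a b => L n ω a b : κ → ι → ℝ)) P :=
    aemeasurable_pi_iff.2 fun a => aemeasurable_pi_iff.2 fun b => hLmeas n a b
  have hLP : TendstoInMeasure P (fun n ω => (fun a b => L n ω a b : κ → ι → ℝ)) atTop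
      (fun _ => (fun a b => A a b : κ → ι → ℝ)) :=
    tendstoInMeasure_of_tendsto_ae (fun n => (hLm n).aestronglyMeasurable) hL
  let g : EuclideanSpace ℝ ι × (κ → ι → ℝ) → EuclideanSpace ℝ κ :=
    fun x => WithLp.toLp 2 (Matrix.of x.2 *ᵥ x.1.ofLp)
  have hg : Continuous g := by
    refine (PiLp.continuous_toLp 2 _).comp (continuous_pi fun a => ?_)
    refine continuous_finsetSum _ fun b _ => ?_
    simp only [Matrix.of_apply]
    fun_prop
  have h1 := hW.continuous_comp_prodMk_of_tendstoInMeasure_const hg hLP hLm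
  let T : EuclideanSpace ℝ ι →L[ℝ] EuclideanSpace ℝ κ :=
    (Matrix.toEuclideanLin A).toContinuousLinearMap
  have h2 : TendstoInDistribution
      (fun (n : ℕ) ω => (√(n : ℝ))⁻¹ • ∑ k ∈ Finset.range n, T (X k ω)) atTop id
      (fun _ => P) (multivariateGaussian 0 S) := by
    refine tendstoInDistribution_inv_sqrt_smul_sum (X := fun k ω => T (X k ω))
      (T.comp_memLp' hX) ?_ (hindep.comp (fun _ => T) fun _ => T.continuous.measurable)
      (fun i => (hident i).comp T.continuous.measurable) hS
    rw [T.integral_comp_comm (hX.integrable one_le_two), h0, map_zero]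
  have h3 := hW.continuous_comp T.continuous
  -- The image of the Gaussian law under A is identified by uniqueness of limits: T applied to the
  -- normalized sums converges both to this image and, by the central limit theorem for T X_k, to
  -- the Gaussian with covariance S.
  have h4 : (multivariateGaussian 0 Γ).map T = multivariateGaussian 0 S := by
    have := tendstoInDistribution_unique _ h3 (by
      convert h2 using 3 with n
      ext1 ω
      simp [Function.comp, map_sum])
    simpa using this
  exact tendstoInDistribution_of_map_eq h1 aemeasurable_id (by rw [Measure.map_id]; exact h4)

end CentralLimit

/-! ### Squared norms of Gaussian vectors. -/

section QuadraticForm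

variable {ι : Type*} [Fintype ι] [DecidableEq ι]

/-- The squared norm of a centred Gaussian vector is a mixture of independent `χ²(1)` variables,
weighted by the eigenvalues of the covariance matrix. -/
theorem map_norm_sq_multivariateGaussian {S : Matrix ι ι ℝ} (hS : S.PosSemidef) :
    (multivariateGaussian 0 S).map (fun x => ‖x‖ ^ 2)
      = (Measure.pi fun _ : ι => chiSqOne).map
          fun w => ∑ i, hS.isHermitian.eigenvalues i * w i := by
  have hpi : (Measure.pi fun _ : ι => chiSqOne)
      = (Measure.pi fun _ : ι => gaussianReal 0 1).map fun x i => x i ^ 2 := by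
    exact (Measure.pi_map_pi (μ := fun _ : ι => gaussianReal 0 1) (f := fun _ x => x ^ 2)
      fun _ => by fun_prop).symm
  -- The standard Gaussian has independent N(0,1) coordinates in every orthonormal basis. In an
  -- eigenbasis of S the form ‖S^{1/2}y‖² = yᵀSy is diagonal, so only a pointwise identity remains.
  rw [hpi, Measure.map_map (by fun_prop) (by fun_prop), multivariateGaussian,
    stdGaussian_eq_map_pi_orthonormalBasis hS.isHermitian.eigenvectorBasis,
    Measure.map_map (by fun_prop) (by fun_prop), Measure.map_map (by fun_prop) (by fun_prop)]
  congr 1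
  ext x
  set b := hS.isHermitian.eigenvectorBasis
  set y : EuclideanSpace ℝ ι := ∑ i, x i • b i with hy
  have hself : (CFC.sqrt S)ᵀ = CFC.sqrt S := by
    exact (CFC.sqrt_nonneg S).posSemidef.isHermitian
  have h1 : ‖(0 : EuclideanSpace ℝ ι) + Matrix.toEuclideanCLM (𝕜 := ℝ) (CFC.sqrt S) y‖ ^ 2
      = inner ℝ y (Matrix.toEuclideanLin S y) := by
    rw [zero_add, EuclideanSpace.real_norm_sq_eq]
    have : ∀ i, (Matrix.toEuclideanCLM (𝕜 := ℝ) (CFC.sqrt S) y) i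
      = (CFC.sqrt S *ᵥ y.ofLp) i := fun i => rfl
    simp_rw [this]
    have h2 : inner ℝ y (Matrix.toEuclideanLin S y) = y.ofLp ⬝ᵥ S *ᵥ y.ofLp := by
      simp [PiLp.inner_apply, dotProduct, mul_comm]
    rw [h2]
    conv_rhs => rw [← CFC.sqrt_mul_sqrt_self S hS.nonneg, ← mulVec_mulVec, dotProduct_mulVec,
      ← mulVec_transpose, hself]
    simp [dotProduct, sq]
  have h3 : Matrix.toEuclideanLin S y = ∑ i, (x i * hS.isHermitian.eigenvalues i) • b i := by
    rw [hy, map_sum]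
    refine Finset.sum_congr rfl fun i _ => ?_
    rw [map_smul, mul_smul]
    congr 1
    apply WithLp.ofLp_injective
    simpa using hS.isHermitian.mulVec_eigenvectorBasis i
  simp only [Function.comp]
  rw [h1, h3, hy, b.orthonormal.inner_sum]
  refine Finset.sum_congr rfl fun i _ => ?_
  simp
  ring

/-- The continuous mapping theorem for the squared norm, with a Gaussian limit. -/
theorem tendstoInDistribution_norm_sq_of_multivariateGaussian {Ω : Type*} [MeasurableSpace Ω]
    {P : Measure Ω} [IsProbabilityMeasure P] {S : Matrix ι ι ℝ} (hS : S.PosSemidef)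
    {X : ℕ → Ω → EuclideanSpace ℝ ι}
    (hX : TendstoInDistribution X atTop id (fun _ => P) (multivariateGaussian 0 S)) :
    TendstoInDistribution (fun n ω => ‖X n ω‖ ^ 2) atTop
      (fun w : ι → ℝ => ∑ i, hS.isHermitian.eigenvalues i * w i)
      (fun _ => P) (Measure.pi fun _ => chiSqOne) := by
  have h := hX.continuous_comp (g := fun x : EuclideanSpace ℝ ι => ‖x‖ ^ 2) (by fun_prop)
  exact tendstoInDistribution_of_map_eq h
    (Finset.measurable_fun_sum _ fun i _ => (measurable_pi_apply i).const_mul _).aemeasurable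
    (map_norm_sq_multivariateGaussian hS)

end QuadraticForm

/-! ### Continuity and measurability of inverse square roots. -/

section InverseSquareRoot

variable {m p r : ℕ}

open scoped Matrix.Norms.L2Operator in
lemma continuousOn_matrix_sqrt :
    ContinuousOn (CFC.sqrt : Matrix (Fin m) (Fin m) ℝ → Matrix (Fin m) (Fin m) ℝ)
      {A | A.PosSemidef} := by
  simpa only [nonneg_iff_posSemidef] using
    CFC.continuousOn_sqrt (A := Matrix (Fin m) (Fin m) ℝ)

lemma isClosed_posSemidef : IsClosed {A : Matrix (Fin m) (Fin m) ℝ | A.PosSemidef} := by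
  have : {A : Matrix (Fin m) (Fin m) ℝ | A.PosSemidef}
      = {A | Aᵀ = A} ∩ ⋂ x : Fin m → ℝ, {A | 0 ≤ x ⬝ᵥ A *ᵥ x} := by
    ext A
    simp [posSemidef_iff_dotProduct_mulVec, IsHermitian]
  rw [this]
  refine (isClosed_eq (by fun_prop) continuous_id).inter (isClosed_iInter fun x => ?_)
  exact isClosed_le continuous_const (by fun_prop)

/-- This default value makes the square root Borel on all matrices: continuous on the closed
positive semidefinite cone, zero off it. -/
lemma matrix_sqrt_of_not_posSemidef {A : Matrix (Fin m) (Fin m) ℝ} (hA : ¬ A.PosSemidef) :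
    CFC.sqrt A = 0 := by
  rw [CFC.sqrt, cfcₙ_apply_of_not_predicate]
  change ¬ (A - 0).PosSemidef
  simpa

lemma invSqrt_posSemidef (A : Matrix (Fin m) (Fin m) ℝ) : (invSqrt A).PosSemidef :=
  (CFC.sqrt_nonneg _).posSemidef

lemma invSqrt_transpose (A : Matrix (Fin m) (Fin m) ℝ) : (invSqrt A)ᵀ = invSqrt A :=
  (invSqrt_posSemidef A).isHermitian

lemma invSqrt_mul_invSqrt {A : Matrix (Fin m) (Fin m) ℝ} (hA : A.PosSemidef) :
    invSqrt A * invSqrt A = A⁻¹ :=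
  CFC.sqrt_mul_sqrt_self _ hA.inv.nonneg

lemma invSqrt_of_not_isUnit {A : Matrix (Fin m) (Fin m) ℝ} (hA : ¬ IsUnit A) :
    invSqrt A = 0 := by
  rw [invSqrt, nonsing_inv_apply_not_isUnit _ (by rwa [← isUnit_iff_isUnit_det]), CFC.sqrt_zero]

lemma isUnit_invSqrt {A : Matrix (Fin m) (Fin m) ℝ} (hA : A.PosDef) : IsUnit (invSqrt A) := by
  have h : IsUnit (invSqrt A * invSqrt A) := by
    rw [invSqrt_mul_invSqrt hA.posSemidef]
    exact hA.inv.isUnit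
  exact isUnit_of_mul_isUnit_left h

lemma isUnit_det_of_posDef {A : Matrix (Fin m) (Fin m) ℝ} (hA : A.PosDef) : IsUnit A.det :=
  hA.det_pos.ne'.isUnit

lemma tendsto_inv_of_posDef {α : Type*} {l : Filter α} {M : α → Matrix (Fin m) (Fin m) ℝ}
    {A : Matrix (Fin m) (Fin m) ℝ} (hA : A.PosDef) (h : Tendsto M l (𝓝 A)) :
    Tendsto (fun i => (M i)⁻¹) l (𝓝 A⁻¹) := by
  refine (continuousAt_matrix_inv A ?_).tendsto.comp h
  rw [show (Ring.inverse : ℝ → ℝ) = fun x => x⁻¹ from funext Ring.inverse_eq_inv]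
  exact continuousAt_inv₀ hA.det_pos.ne'

/-- The square root is continuous only within the positive semidefinite cone, which is why every `M
i` must lie in it. The inverses stay there, including the default inverse 0 of a singular matrix. -/
lemma tendsto_invSqrt {α : Type*} {l : Filter α} {M : α → Matrix (Fin m) (Fin m) ℝ}
    {A : Matrix (Fin m) (Fin m) ℝ} (hA : A.PosDef) (hM : ∀ i, (M i).PosSemidef)
    (h : Tendsto M l (𝓝 A)) : Tendsto (fun i => invSqrt (M i)) l (𝓝 (invSqrt A)) := by
  have hinv := tendsto_inv_of_posDef hA h
  refine (continuousOn_matrix_sqrt A⁻¹ hA.inv.posSemidef).tendsto.comp ?_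
  exact tendsto_nhdsWithin_iff.2 ⟨hinv, .of_forall fun i => (hM i).inv⟩

/-- By Cramer's rule each entry is a cofactor times the inverse of the determinant; scalar inversion
with 0⁻¹ = 0 is measurable, so singular matrices cause no trouble. -/
lemma measurable_matrix_inv_apply {α : Type*} [MeasurableSpace α]
    {M : α → Matrix (Fin m) (Fin m) ℝ} (hM : ∀ a b, Measurable fun x => M x a b) (a b : Fin m) :
    Measurable fun x => (M x)⁻¹ a b := by
  have hdet : ∀ (N : α → Matrix (Fin m) (Fin m) ℝ), (∀ a b, Measurable fun x => N x a b) →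
      Measurable fun x => (N x).det := fun N hN => by
    simp only [det_apply]
    refine Finset.measurable_fun_sum _ fun σ _ => Measurable.const_smul ?_ _
    exact Finset.measurable_fun_prod _ fun i _ => hN _ _
  simp only [inv_def, Matrix.smul_apply, adjugate_apply, Ring.inverse_eq_inv', smul_eq_mul]
  refine (hdet M hM).inv.mul (hdet (fun x => (M x).updateRow b (Pi.single a 1)) fun c d => ?_)
  simp only [updateRow_apply]
  split_ifs
  · exact measurable_const
  · exact hM c d

lemma measurable_invSqrt_apply {α : Type*} [MeasurableSpace α]
    {M : α → Matrix (Fin m) (Fin m) ℝ} (hM : ∀ a b, Measurable fun x => M x a b) (a b : Fin m) :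
    Measurable fun x => invSqrt (M x) a b := by
  let e : (Fin m → Fin m → ℝ) → Matrix (Fin m) (Fin m) ℝ := Matrix.of
  have hclosed : IsClosed {A : Fin m → Fin m → ℝ | (e A).PosSemidef} :=
    isClosed_posSemidef.preimage (show Continuous e from continuous_id)
  classical
  have hsqrt : Measurable fun A : Fin m → Fin m → ℝ => CFC.sqrt (e A) a b := by
    have heq : (fun A : Fin m → Fin m → ℝ => CFC.sqrt (e A) a b)
        = {A : Fin m → Fin m → ℝ | (e A).PosSemidef}.piecewise
          (fun A => CFC.sqrt (e A) a b) (fun _ => 0) := by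
      ext A
      by_cases hA : (e A).PosSemidef
      · simp [Set.piecewise, hA]
      · simp [Set.piecewise, hA, matrix_sqrt_of_not_posSemidef hA]
    rw [heq]
    refine ContinuousOn.measurable_piecewise ?_ continuousOn_const hclosed.measurableSet
    have h1 : ContinuousOn (fun A : Matrix (Fin m) (Fin m) ℝ => CFC.sqrt A)
      {A | A.PosSemidef} := continuousOn_matrix_sqrt
    exact (continuous_apply_apply a b).comp_continuousOn h1
  exact hsqrt.comp (measurable_pi_lambda _ fun c => measurable_pi_lambda _ fun d =>
    measurable_matrix_inv_apply hM c d)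

lemma measurable_mul_apply {α ι κ l : Type*} [Fintype κ] [MeasurableSpace α]
    {M : α → Matrix ι κ ℝ} {N : α → Matrix κ l ℝ} (hM : ∀ a b, Measurable fun x => M x a b)
    (hN : ∀ a b, Measurable fun x => N x a b) (a : ι) (b : l) :
    Measurable fun x => (M x * N x) a b := by
  simp only [Matrix.mul_apply]
  exact Finset.measurable_fun_sum _ fun c _ => (hM a c).mul (hN c b)

/-- The matrix `(αₓᵀ S⁻¹ αₓ)^{-1/2} αₓᵀ S⁻¹`, i.e. `αᵀ S^{-1/2}` for the orthonormalized basis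
`α`. -/
noncomputable def scoreMatrix (S : Matrix (Fin p) (Fin p) ℝ) (αx : Matrix (Fin p) (Fin r) ℝ) :
    Matrix (Fin r) (Fin p) ℝ :=
  invSqrt (αxᵀ * S⁻¹ * αx) * αxᵀ * S⁻¹

/-- The two factors S^{-1/2} merge into S⁻¹, so αᵀZ and its sample version depend on S only through
its inverse and one r × r square root. -/
lemma orthoBasis_transpose_mul_invSqrt {S : Matrix (Fin p) (Fin p) ℝ} (hS : S.PosSemidef)
    (αx : Matrix (Fin p) (Fin r) ℝ) :
    (orthoBasis S αx)ᵀ * invSqrt S = scoreMatrix S αx := by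
  rw [orthoBasis, scoreMatrix, transpose_mul, transpose_mul, invSqrt_transpose, invSqrt_transpose,
    ← Matrix.mul_assoc, Matrix.mul_assoc _ (invSqrt S), invSqrt_mul_invSqrt hS]

lemma posSemidef_conj_inv {S : Matrix (Fin p) (Fin p) ℝ} (hS : S.PosSemidef)
    (αx : Matrix (Fin p) (Fin r) ℝ) : (αxᵀ * S⁻¹ * αx).PosSemidef := by
  simpa using hS.inv.conjTranspose_mul_mul_same αx

lemma mulVec_injective_of_rank_eq {αx : Matrix (Fin p) (Fin r) ℝ} (h : αx.rank = r) :
    Function.Injective αx.mulVec := by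
  have hr : Module.finrank ℝ (LinearMap.range αx.mulVecLin) = r := h
  have := LinearMap.finrank_range_add_finrank_ker αx.mulVecLin
  rw [hr, Module.finrank_fin_fun, Nat.add_eq_left, Submodule.finrank_eq_zero] at this
  exact LinearMap.ker_eq_bot.1 this

lemma posDef_conj_inv {S : Matrix (Fin p) (Fin p) ℝ} (hS : S.PosDef)
    {αx : Matrix (Fin p) (Fin r) ℝ} (h : αx.rank = r) : (αxᵀ * S⁻¹ * αx).PosDef := by
  simpa using hS.inv.conjTranspose_mul_mul_same (mulVec_injective_of_rank_eq h)

lemma tendsto_scoreMatrix {α : Type*} {l : Filter α} {M : α → Matrix (Fin p) (Fin p) ℝ}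
    {S : Matrix (Fin p) (Fin p) ℝ} (hS : S.PosDef) (hM : ∀ i, (M i).PosSemidef)
    (hMS : Tendsto M l (𝓝 S)) {αx : Matrix (Fin p) (Fin r) ℝ} (hαx : αx.rank = r) :
    Tendsto (fun i => scoreMatrix (M i) αx) l (𝓝 (scoreMatrix S αx)) := by
  have hinv := tendsto_inv_of_posDef hS hMS
  have hconj : Continuous fun x : Matrix (Fin p) (Fin p) ℝ => αxᵀ * x * αx :=
    (continuous_const.matrix_mul continuous_id).matrix_mul continuous_const
  have hK : Tendsto (fun i => αxᵀ * (M i)⁻¹ * αx) l (𝓝 (αxᵀ * S⁻¹ * αx)) :=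
    (hconj.tendsto S⁻¹).comp hinv
  have hsq := tendsto_invSqrt (posDef_conj_inv hS hαx) (fun i => posSemidef_conj_inv (hM i) αx) hK
  have hmul : Continuous fun x : Matrix (Fin r) (Fin r) ℝ × Matrix (Fin p) (Fin p) ℝ =>
      x.1 * αxᵀ * x.2 :=
    (continuous_fst.matrix_mul continuous_const).matrix_mul continuous_snd
  have := (hmul.tendsto (invSqrt (αxᵀ * S⁻¹ * αx), S⁻¹)).comp (hsq.prodMk_nhds hinv)
  simp only [scoreMatrix]
  exact this

lemma measurable_scoreMatrix_apply {α : Type*} [MeasurableSpace α]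
    {M : α → Matrix (Fin p) (Fin p) ℝ} (hM : ∀ a b, Measurable fun x => M x a b)
    (αx : Matrix (Fin p) (Fin r) ℝ) (a : Fin r) (b : Fin p) :
    Measurable fun x => scoreMatrix (M x) αx a b := by
  have hinv := measurable_matrix_inv_apply hM
  have hl : ∀ a b, Measurable fun x => (αxᵀ * (M x)⁻¹) a b :=
    measurable_mul_apply (M := fun _ => αxᵀ) (N := fun x => (M x)⁻¹)
      (fun _ _ => measurable_const) hinv
  have hK : ∀ a b, Measurable fun x => (αxᵀ * (M x)⁻¹ * αx) a b :=
    measurable_mul_apply (M := fun x => αxᵀ * (M x)⁻¹) (N := fun _ => αx)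
      hl fun _ _ => measurable_const
  have hsq : ∀ a b, Measurable fun x => invSqrt (αxᵀ * (M x)⁻¹ * αx) a b :=
    measurable_invSqrt_apply hK
  have hr : ∀ a b, Measurable fun x => (invSqrt (αxᵀ * (M x)⁻¹ * αx) * αxᵀ) a b :=
    measurable_mul_apply (M := fun x => invSqrt (αxᵀ * (M x)⁻¹ * αx)) (N := fun _ => αxᵀ)
      hsq fun _ _ => measurable_const
  exact measurable_mul_apply (M := fun x => invSqrt (αxᵀ * (M x)⁻¹ * αx) * αxᵀ)
    (N := fun x => (M x)⁻¹) hr hinv a b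

end InverseSquareRoot

/-! ### Orthonormality of the basis and its projection matrix. -/

section Projection

variable {p r : ℕ}

lemma orthoBasis_transpose_mul_self {S : Matrix (Fin p) (Fin p) ℝ} (hS : S.PosDef)
    {αx : Matrix (Fin p) (Fin r) ℝ} (hαx : αx.rank = r) :
    (orthoBasis S αx)ᵀ * orthoBasis S αx = 1 := by
  have hK := posDef_conj_inv hS hαx
  set K := αxᵀ * S⁻¹ * αx with hKdef
  have h1 : (orthoBasis S αx)ᵀ * orthoBasis S αx = invSqrt K * K * invSqrt K := by
    rw [orthoBasis, ← hKdef, transpose_mul, transpose_mul, invSqrt_transpose, invSqrt_transpose]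
    have : K = αxᵀ * (invSqrt S * invSqrt S) * αx := by rw [invSqrt_mul_invSqrt hS.posSemidef]
    rw [congrArg (fun N => invSqrt K * N * invSqrt K) this]
    simp only [Matrix.mul_assoc]
  have h2 : invSqrt K * (invSqrt K * K) = 1 := by
    rw [← Matrix.mul_assoc, invSqrt_mul_invSqrt hK.posSemidef,
      nonsing_inv_mul _ (isUnit_det_of_posDef hK)]
  have h3 : invSqrt K * K * invSqrt K = 1 := by
    -- A one-sided inverse of a square matrix is two-sided, so K^{-1/2} need not be shown to commute
    -- with K.
    rw [← mul_eq_one_comm]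
    exact h2
  rw [h1, h3]

lemma colSpan_mul_of_isUnit (A : Matrix (Fin p) (Fin r) ℝ) {B : Matrix (Fin r) (Fin r) ℝ}
    (hB : IsUnit B) : colSpan (A * B) = colSpan A := by
  apply le_antisymm
  · rintro _ ⟨x, rfl⟩
    refine ⟨Matrix.toEuclideanLin B x, ?_⟩
    apply WithLp.ofLp_injective
    simp [Matrix.toEuclideanLin, mulVec_mulVec]
  · rintro _ ⟨x, rfl⟩
    refine ⟨Matrix.toEuclideanLin B⁻¹ x, ?_⟩
    apply WithLp.ofLp_injective
    simp [Matrix.toEuclideanLin, mulVec_mulVec,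
      mul_nonsing_inv _ ((isUnit_iff_isUnit_det _).1 hB)]

lemma projMatrix_colSpan {A : Matrix (Fin p) (Fin r) ℝ} (hA : Aᵀ * A = 1) :
    projMatrix (colSpan A) = A * Aᵀ := by
  rw [projMatrix, LinearEquiv.symm_apply_eq]
  ext1 x
  refine Submodule.eq_starProjection_of_mem_of_inner_eq_zero ?_ ?_
  · refine ⟨Matrix.toEuclideanLin Aᵀ x, ?_⟩
    apply WithLp.ofLp_injective
    simp [Matrix.toEuclideanLin, mulVec_mulVec]
  · rintro _ ⟨y, rfl⟩
    have h1 : inner ℝ (x - Matrix.toEuclideanLin (A * Aᵀ) x) (Matrix.toEuclideanLin A y)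
        = (x.ofLp - (A * Aᵀ) *ᵥ x.ofLp) ⬝ᵥ A *ᵥ y.ofLp := by
      simp [PiLp.inner_apply, dotProduct, mul_comm, Matrix.toEuclideanLin]
    have h2 : Aᵀ *ᵥ (x.ofLp - (A * Aᵀ) *ᵥ x.ofLp) = 0 := by
      rw [mulVec_sub, mulVec_mulVec, ← Matrix.mul_assoc, hA, Matrix.one_mul, sub_self]
    exact h1.trans (by rw [dotProduct_mulVec, ← mulVec_transpose, h2, zero_dotProduct])

lemma projMatrix_bot : projMatrix (⊥ : Submodule ℝ (EuclideanSpace ℝ (Fin p))) = 0 := by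
  simp [projMatrix]

end Projection

/-! ### Conditional independence and the vanishing of αₓᵀβ_y. -/

section Population

/-- If `f` and `g` are conditionally independent given `m` and `u ∘ g` has zero conditional
expectation, then `u ∘ g` is uncorrelated with every function of `f`. -/
lemma integral_mul_eq_zero_of_condIndepFun {Ω β γ : Type*} {m : MeasurableSpace Ω}
    [mΩ : MeasurableSpace Ω] [StandardBorelSpace Ω] [MeasurableSpace β] [MeasurableSpace γ]
    [MeasurableSpace.CountablyGenerated β] [MeasurableSpace.CountablyGenerated γ]
    {hm : m ≤ mΩ} {ν : Measure Ω} [IsFiniteMeasure ν] {f : Ω → β} {g : Ω → γ}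
    (hf : Measurable f) (hg : Measurable g) (hfg : CondIndepFun m hm f g ν)
    {v : β → ℝ} {u : γ → ℝ} (hv : Measurable v) (hu : Measurable u)
    (huint : Integrable (fun ω => u (g ω)) ν)
    (hvu : Integrable (fun ω => v (f ω) * u (g ω)) ν)
    (hzero : ν[fun ω => u (g ω) | m] =ᵐ[ν] 0) :
    ∫ ω, v (f ω) * u (g ω) ∂ν = 0 := by
  -- Conditional independence says that for almost every ω the conditional joint law of (f, g) is a
  -- product, so the conditional expectation of v(f)u(g) factors and its second factor is zero.
  have hker := ae_of_ae_trim hm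
    ((condIndepFun_iff_map_prod_eq_prod_map_map (hm' := hm) hf hg).1 hfg)
  have h1 := condExp_ae_eq_integral_condExpKernel hm hvu
  have h2 := condExp_ae_eq_integral_condExpKernel hm huint
  rw [← integral_condExp hm (f := fun ω => v (f ω) * u (g ω))]
  refine integral_eq_zero_of_ae ?_
  filter_upwards [hker, h1, h2, hzero] with ω hω h1 h2 h3
  rw [h1]
  set κ := condExpKernel ν m ω
  rw [h2] at h3
  have hmap : κ.map (fun x => (f x, g x)) = (κ.map f).prod (κ.map g) := by
    rw [Kernel.map_apply _ (hf.prodMk hg), Kernel.prod_apply, Kernel.map_apply _ hf,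
      Kernel.map_apply _ hg] at hω
    exact hω
  have h4 : ∫ x, v (f x) * u (g x) ∂κ = ∫ z, v z.1 * u z.2 ∂(κ.map (fun x => (f x, g x))) := by
    rw [integral_map (hf.prodMk hg).aemeasurable (by fun_prop)]
  rw [h4, hmap, integral_prod_mul, integral_map hg.aemeasurable (by fun_prop), h3]
  simp

variable {p h r : ℕ} {ν : Measure (Obs p h)}

lemma measurable_sliceInd (y : Fin h) : Measurable (sliceInd (p := p) y) :=
  (measurable_from_top (f := fun y' : Fin h => if y' = y then (1 : ℝ) else 0)).comp measurable_snd

lemma integral_sliceInd (y : Fin h) : ∫ z, sliceInd y z ∂ν = sliceProb ν y := by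
  have hm : MeasurableSet {z : Obs p h | z.2 = y} :=
    measurable_snd (MeasurableSet.singleton y)
  have : (sliceInd y : Obs p h → ℝ) = {z : Obs p h | z.2 = y}.indicator 1 := by
    ext z
    simp [sliceInd, Set.indicator]
  rw [this, integral_indicator_one hm, sliceProb]

lemma popMean_apply (hmom : MemLp (fun z : Obs p h => z.1) 1 ν) (k : Fin p) :
    popMean ν k = ∫ z, z.1 k ∂ν :=
  ((EuclideanSpace.proj (𝕜 := ℝ) k : EuclideanSpace ℝ (Fin p) →L[ℝ] ℝ).integral_comp_comm
    (memLp_one_iff_integrable.1 hmom)).symm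

variable [IsProbabilityMeasure ν]

lemma memLp_sliceInd (y : Fin h) (q : ENNReal) : MemLp (sliceInd (p := p) y) q ν := by
  refine MemLp.of_bound (measurable_sliceInd y).aestronglyMeasurable 1 (.of_forall fun z => ?_)
  unfold sliceInd
  split_ifs <;> simp

lemma memLp_stdPred {q : ENNReal} (hmom : MemLp (fun z : Obs p h => z.1) q ν) :
    MemLp (stdPred ν) q ν :=
  (Matrix.toEuclideanLin (invSqrt (popCov ν))).toContinuousLinearMap.comp_memLp'
    (hmom.sub (memLp_const _))

lemma cov_sliceInd (hmom : MemLp (fun z : Obs p h => z.1) 2 ν) (y : Fin h) (k : Fin p) :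
    cov[fun z : Obs p h => z.1 k, sliceInd y; ν]
      = ∫ z, (z.1 - popMean ν) k * sliceInd y z ∂ν := by
  have hm1 := hmom.mono_exponent one_le_two
  have hk : MemLp (fun z : Obs p h => z.1 k) 2 ν := memLp_apply hmom k
  rw [covariance, ← popMean_apply hm1 k, integral_sliceInd]
  have hint : Integrable (fun z : Obs p h => (z.1 - popMean ν) k) ν :=
    (memLp_apply (hm1.sub (memLp_const _)) k).integrable le_rfl
  have hint2 : Integrable (fun z : Obs p h => (z.1 - popMean ν) k * sliceInd y z) ν :=
    (memLp_apply (hmom.sub (memLp_const _)) k).integrable_mul (memLp_sliceInd y 2)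
  have hzero : ∫ z : Obs p h, (z.1 - popMean ν) k ∂ν = 0 := by
    simp only [PiLp.sub_apply]
    rw [integral_sub (hk.integrable one_le_two) (integrable_const _), ← popMean_apply hm1 k]
    simp
  have : ∀ z : Obs p h, (z.1 k - popMean ν k) * (sliceInd y z - sliceProb ν y)
      = (z.1 - popMean ν) k * sliceInd y z - (z.1 - popMean ν) k * sliceProb ν y := fun z => by
    simp only [PiLp.sub_apply]; ring
  simp_rw [this]
  rw [integral_sub hint2 (hint.mul_const _), integral_mul_const, hzero]
  simp

/-- Under the linearity condition and the coordinate hypothesis, `αₓᵀ β_y = 0`. -/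
lemma transpose_mulVec_olsCoef_eq_zero (hmom : MemLp (fun z : Obs p h => z.1) 2 ν)
    (hcov : (popCov ν).PosDef) (hcentral : CentralSubspaceExists ν)
    {αx : Matrix (Fin p) (Fin r) ℝ} (hlin : LinearityCondition ν)
    (hcoord : CoordinateHypothesis ν αx) (y : Fin h) : αxᵀ *ᵥ olsCoef ν y = 0 := by
  have hm1 := hmom.mono_exponent one_le_two
  ext k
  -- The k-th column of Σ^{-1/2}αₓ.
  set u : EuclideanSpace ℝ (Fin p) := Matrix.toEuclideanLin (invSqrt (popCov ν) * αx)
    (EuclideanSpace.single k 1) with hu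
  have hmem : u ∈ hypSubspace (popCov ν) αx := ⟨_, rfl⟩
  -- The projection onto 𝓗 is self-adjoint, fixes u and kills the central subspace.
  have horth : ∀ s ∈ centralSubspace ν, inner ℝ u s = 0 := by
    intro s hs
    have h0 : (hypSubspace (popCov ν) αx).starProjection s = 0 := by
      have : (hypSubspace (popCov ν) αx).starProjection s
          ∈ (centralSubspace ν).map (hypSubspace (popCov ν) αx).starProjection.toLinearMap :=
        ⟨s, hs, rfl⟩
      rwa [hcoord, Submodule.mem_bot] at this
    rw [← Submodule.starProjection_eq_self_iff.2 hmem,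
      Submodule.inner_starProjection_left_eq_right, h0, inner_zero_right]
  have hzero : ν[fun z => inner ℝ u (stdPred ν z) | projSigma ν (centralSubspace ν)] =ᵐ[ν] 0 := by
    have h1 := (innerSL ℝ u).comp_condExp_comm (m := projSigma ν (centralSubspace ν))
      ((memLp_stdPred hm1).integrable le_rfl)
    refine h1.symm.trans ?_
    filter_upwards [hlin] with z hz
    simp only [Function.comp, hz, innerSL_apply_apply, Pi.zero_apply]
    exact horth _ (Submodule.starProjection_apply_mem _ _)
  have hprod := integral_mul_eq_zero_of_condIndepFun (β := Fin h)
    measurable_snd (measurable_stdPred ν) hcentral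
    (v := fun y' => if y' = y then 1 else 0) (u := fun x => inner ℝ u x)
    measurable_from_top (by fun_prop)
    (((memLp_stdPred hm1).const_inner u).integrable le_rfl)
    ((memLp_sliceInd y 2).integrable_mul ((memLp_stdPred hmom).const_inner u)) hzero
  have hS : (popCov ν).PosSemidef := hcov.posSemidef
  -- uᵀZ is entry k of αₓᵀΣ⁻¹(X - EX), which turns `hprod` into a statement about Cov(X, J_y).
  have hpt : ∀ z : Obs p h, (if z.2 = y then 1 else 0) * inner ℝ u (stdPred ν z)
      = ∑ l, (αxᵀ * (popCov ν)⁻¹) k l * ((z.1 - popMean ν) l * sliceInd y z) := by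
    intro z
    have h1 : inner ℝ u (stdPred ν z)
        = ((αxᵀ * (popCov ν)⁻¹) *ᵥ (z.1 - popMean ν).ofLp) k := by
      have h2 : inner ℝ u (stdPred ν z) = ((invSqrt (popCov ν) * αx) *ᵥ Pi.single k 1)
          ⬝ᵥ (invSqrt (popCov ν) *ᵥ (z.1 - popMean ν).ofLp) := by
        rw [EuclideanSpace.inner_eq_star_dotProduct, star_trivial, dotProduct_comm]
        rfl
      rw [h2, dotProduct_comm, dotProduct_mulVec, ← mulVec_transpose, mulVec_mulVec,
        transpose_mul, invSqrt_transpose, Matrix.mul_assoc, invSqrt_mul_invSqrt hS]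
      simp
    rw [h1, mulVec, dotProduct, Finset.mul_sum]
    refine Finset.sum_congr rfl fun l _ => ?_
    rw [sliceInd]
    ring
  have hint (l : Fin p) : Integrable (fun z : Obs p h =>
      (αxᵀ * (popCov ν)⁻¹) k l * ((z.1 - popMean ν) l * sliceInd y z)) ν :=
    ((memLp_apply (hmom.sub (memLp_const _)) l).integrable_mul (memLp_sliceInd y 2)).const_mul _
  rw [integral_congr_ae (.of_forall hpt), integral_finsetSum _ fun l _ => hint l] at hprod
  simp only [integral_const_mul, ← cov_sliceInd hmom] at hprod
  rw [olsCoef, mulVec_mulVec]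
  exact hprod

end Population

/-! ### Exact representation of the statistic by a normalized sum. -/

noncomputable section

variable {p h r : ℕ}

/-- The summands of the central limit theorem: the products `ε_y (X - E X)` together with `ε_y`. -/
def scoreVec (ν : Measure (Obs p h)) (z : Obs p h) : EuclideanSpace ℝ (Fin h × Option (Fin p)) :=
  WithLp.toLp 2 fun a => olsResid ν z a.1 * a.2.elim 1 fun l => (z.1 - popMean ν) l

/-- The matrix that maps the normalized sum of the `scoreVec`s to `√n vec(α̂ᵀ ℤₙ)`. -/
def weightMatrix (f : Fin h → ℝ) (B : Matrix (Fin r) (Fin p) ℝ) (d : Fin p → ℝ) :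
    Matrix (Fin h × Fin r) (Fin h × Option (Fin p)) ℝ :=
  Matrix.diagonal (fun y => (√(f y))⁻¹) ⊗ₖ
    Matrix.of fun k o => o.elim (-(B *ᵥ d) k) fun l => B k l

/-- The `none` coordinate carries the sum of ε_y; its weight -Bd corrects for centring at the sample
mean instead of EX. Since d tends to 0, it drops out of the limit. -/
lemma weightMatrix_mulVec_apply (f : Fin h → ℝ) (B : Matrix (Fin r) (Fin p) ℝ) (d : Fin p → ℝ)
    (v : Fin h × Option (Fin p) → ℝ) (a : Fin h × Fin r) :
    (weightMatrix f B d *ᵥ v) a = (√(f a.1))⁻¹ *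
      ((B *ᵥ fun l => v (a.1, some l)) a.2 - v (a.1, none) * (B *ᵥ d) a.2) := by
  simp only [weightMatrix, mulVec, dotProduct, kroneckerMap_apply, Fintype.sum_prod_type,
    Fintype.sum_option, Matrix.diagonal_apply, Matrix.of_apply, Option.elim]
  rw [Finset.sum_eq_single a.1 (fun y _ hy => by simp [hy.symm]) (by simp)]
  simp only [if_true, mul_sub, Finset.mul_sum, mul_assoc]
  rw [sub_eq_add_neg, add_comm]
  congr 1
  rw [neg_mul, mul_neg, Finset.sum_mul, Finset.mul_sum, ← Finset.mul_sum, ← Finset.mul_sum]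
  congr 2
  exact Finset.sum_congr rfl fun l _ => by ring

section Sample

variable (s : ℕ → Obs p h) (n : ℕ)

lemma sampleCov_posSemidef : (sampleCov s n).PosSemidef := by
  refine PosSemidef.smul ?_ (by positivity)
  refine posSemidef_sum _ fun i _ => ?_
  simpa using posSemidef_vecMulVec_self_star ((s i).1 - sampleMean s n).ofLp

lemma sum_sub_sampleMean : ∑ i ∈ Finset.range n, ((s i).1 - sampleMean s n) = 0 := by
  rcases Nat.eq_zero_or_pos n with rfl | hn
  · simp
  · rw [Finset.sum_sub_distrib, Finset.sum_const, Finset.card_range, sampleMean,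
      ← Nat.cast_smul_eq_nsmul ℝ, smul_smul, mul_inv_cancel₀ (by positivity), one_smul, sub_self]

/-- This removes the regression part of the slice sums for every sample: S⁻¹ cancels S, and for
singular S the default S⁻¹ = 0 gives zero outright. -/
lemma scoreMatrix_mul_self_mulVec_eq_zero (S : Matrix (Fin p) (Fin p) ℝ)
    {αx : Matrix (Fin p) (Fin r) ℝ} {β : Fin p → ℝ} (hβ : αxᵀ *ᵥ β = 0) :
    scoreMatrix S αx *ᵥ (S *ᵥ β) = 0 := by
  by_cases hS : IsUnit S.det
  · rw [mulVec_mulVec, scoreMatrix, Matrix.mul_assoc, nonsing_inv_mul _ hS, Matrix.mul_one,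
      ← mulVec_mulVec, hβ, mulVec_zero]
  · simp [scoreMatrix, nonsing_inv_apply_not_isUnit _ hS]

/-- The centred slice sums in terms of the residuals. -/
lemma sum_slice_sub_sampleMean (ν : Measure (Obs p h)) (y : Fin h) :
    ∑ i ∈ Finset.range n with (s i).2 = y, ((s i).1 - sampleMean s n).ofLp
      = (n : ℝ) • (sampleCov s n *ᵥ olsCoef ν y)
        + (∑ i ∈ Finset.range n, olsResid ν (s i) y • ((s i).1 - popMean ν).ofLp
          - (∑ i ∈ Finset.range n, olsResid ν (s i) y) • (sampleMean s n - popMean ν).ofLp) := by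
  rcases Nat.eq_zero_or_pos n with rfl | hn
  · simp
  have hn' : (n : ℝ) ≠ 0 := by positivity
  set b := olsCoef ν y
  have h0 : ∑ i ∈ Finset.range n, ((s i).1 - sampleMean s n).ofLp = 0 := by
    simpa using congrArg WithLp.ofLp (sum_sub_sampleMean s n)
  have hcov : (n : ℝ) • (sampleCov s n *ᵥ b) = ∑ i ∈ Finset.range n,
      (b ⬝ᵥ ((s i).1 - sampleMean s n).ofLp) • ((s i).1 - sampleMean s n).ofLp := by
    rw [sampleCov, smul_mulVec, smul_smul, mul_inv_cancel₀ hn', one_smul, sum_mulVec]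
    refine Finset.sum_congr rfl fun i _ => ?_
    rw [vecMulVec_mulVec, dotProduct_comm]
    ext l
    simp [mul_comm]
  -- Here J_y is rewritten through ε_y, and X - EX through X - X̄ and X̄ - EX. The last group is a
  -- constant times X - X̄ and sums to zero.
  have hpt : ∀ i ∈ Finset.range n, (if (s i).2 = y then ((s i).1 - sampleMean s n).ofLp else 0)
      = (b ⬝ᵥ ((s i).1 - sampleMean s n).ofLp) • ((s i).1 - sampleMean s n).ofLp
        + (olsResid ν (s i) y • ((s i).1 - popMean ν).ofLp
          - olsResid ν (s i) y • (sampleMean s n - popMean ν).ofLp)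
        + (sliceProb ν y + b ⬝ᵥ (sampleMean s n - popMean ν).ofLp)
          • ((s i).1 - sampleMean s n).ofLp := by
    intro i _
    have h1 : ((s i).1 - popMean ν).ofLp
        = ((s i).1 - sampleMean s n).ofLp + (sampleMean s n - popMean ν).ofLp := by
      simp
    have h2 : (if (s i).2 = y then ((s i).1 - sampleMean s n).ofLp else 0)
        = sliceInd y (s i) • ((s i).1 - sampleMean s n).ofLp := by
      simp [sliceInd]
    have h3 : sliceInd y (s i) = olsResid ν (s i) y + sliceProb ν y
        + (b ⬝ᵥ ((s i).1 - sampleMean s n).ofLp + b ⬝ᵥ (sampleMean s n - popMean ν).ofLp) := by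
      rw [← dotProduct_add, ← h1, olsResid]
      ring
    rw [h2, h3, h1]
    module
  rw [Finset.sum_filter, Finset.sum_congr rfl hpt, Finset.sum_add_distrib, Finset.sum_add_distrib,
    Finset.sum_sub_distrib, ← Finset.smul_sum, h0, smul_zero, add_zero, hcov, Finset.sum_smul]

lemma orthoBasis_transpose_mulVec_sliceMean (αx : Matrix (Fin p) (Fin r) ℝ) (y : Fin h) :
    (orthoBasis (sampleCov s n) αx)ᵀ *ᵥ (sliceMean s n y).ofLp
      = (sliceCount s n y : ℝ)⁻¹ • scoreMatrix (sampleCov s n) αx *ᵥ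
        ∑ i ∈ Finset.range n with (s i).2 = y, ((s i).1 - sampleMean s n).ofLp := by
  have h1 : (sliceMean s n y).ofLp = (sliceCount s n y : ℝ)⁻¹ • invSqrt (sampleCov s n) *ᵥ
        ∑ i ∈ Finset.range n with (s i).2 = y, ((s i).1 - sampleMean s n).ofLp := by
    rw [sliceMean, WithLp.ofLp_smul, WithLp.ofLp_sum, mulVec_sum]
    rfl
  rw [h1, mulVec_smul, mulVec_mulVec,
    orthoBasis_transpose_mul_invSqrt (sampleCov_posSemidef s n)]

/-- The statistic `√n vec(α̂ᵀ ℤₙ)` as a random matrix applied to a normalized sum of independent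
vectors. -/
theorem coordVector_eq (ν : Measure (Obs p h)) {αx : Matrix (Fin p) (Fin r) ℝ}
    (hβ : ∀ y, αxᵀ *ᵥ olsCoef ν y = 0) :
    coordVector s n αx = WithLp.toLp 2 (weightMatrix (sampleProb s n)
      (scoreMatrix (sampleCov s n) αx) (sampleMean s n - popMean ν).ofLp *ᵥ
        ((√(n : ℝ))⁻¹ • ∑ i ∈ Finset.range n, scoreVec ν (s i)).ofLp) := by
  apply WithLp.ofLp_injective
  funext a
  obtain ⟨y, k⟩ := a
  set B := scoreMatrix (sampleCov s n) αx with hB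
  set d := (sampleMean s n - popMean ν).ofLp with hd
  have hleft : (coordVector s n αx).ofLp (y, k) = √(n : ℝ) * (√(sampleProb s n y) *
      ((orthoBasis (sampleCov s n) αx)ᵀ *ᵥ (sliceMean s n y).ofLp) k) := by
    simp only [coordVector, Zn, vec, Pi.smul_apply, smul_eq_mul, Matrix.mul_apply, mulVec,
      dotProduct, Matrix.of_apply, Finset.mul_sum]
    exact Finset.sum_congr rfl fun l _ => by ring
  have hsome : (fun l => ((√(n : ℝ))⁻¹ • ∑ i ∈ Finset.range n, scoreVec ν (s i)).ofLp (y, some l))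
      = (√(n : ℝ))⁻¹ • ∑ i ∈ Finset.range n, olsResid ν (s i) y • ((s i).1 - popMean ν).ofLp := by
    ext l
    simp [scoreVec]
  have hnone : ((√(n : ℝ))⁻¹ • ∑ i ∈ Finset.range n, scoreVec ν (s i)).ofLp (y, none)
      = (√(n : ℝ))⁻¹ * ∑ i ∈ Finset.range n, olsResid ν (s i) y := by
    simp [scoreVec]
  have hright := weightMatrix_mulVec_apply (sampleProb s n) B d
    ((√(n : ℝ))⁻¹ • ∑ i ∈ Finset.range n, scoreVec ν (s i)).ofLp (y, k)
  rw [hsome, hnone] at hright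
  -- This is n_y/n in place of f_y; for n = 0 or an empty slice both sides are zero by the
  -- conventions for inverses.
  have hscal : √(n : ℝ) * (√(sampleProb s n y) * (sliceCount s n y : ℝ)⁻¹)
      = (√(sampleProb s n y))⁻¹ * (√(n : ℝ))⁻¹ := by
    rcases Nat.eq_zero_or_pos n with rfl | hn
    · simp
    have hn' : (0 : ℝ) < n := by positivity
    rw [sampleProb]
    rcases Nat.eq_zero_or_pos (sliceCount s n y) with hc | hc
    · simp [hc]
    have hc' : (0 : ℝ) < sliceCount s n y := by positivity
    rw [Real.sqrt_div hc'.le]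
    have h1 := Real.sqrt_pos.2 hn'
    have h2 := Real.sqrt_pos.2 hc'
    have h3 := Real.sq_sqrt hc'.le
    field_simp
    exact h3
  rw [hleft, orthoBasis_transpose_mulVec_sliceMean, sum_slice_sub_sampleMean s n ν y, ← hB, ← hd,
    mulVec_add, mulVec_smul, scoreMatrix_mul_self_mulVec_eq_zero _ (hβ y), smul_zero, zero_add,
    mulVec_sub, mulVec_smul]
  refine Eq.trans ?_ hright.symm
  rw [mulVec_smul]
  simp only [Pi.smul_apply, Pi.sub_apply, smul_eq_mul]
  linear_combination ((B *ᵥ ∑ i ∈ Finset.range n, olsResid ν (s i) y • ((s i).1 - popMean ν).ofLp) k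
    - (∑ i ∈ Finset.range n, olsResid ν (s i) y) * (B *ᵥ d) k) * hscal

lemma Mhat_eq : Mhat s n = Zn s n * (Zn s n)ᵀ := by
  ext a b
  simp only [Mhat, Matrix.sum_apply, Matrix.smul_apply, vecMulVec_apply, smul_eq_mul,
    Matrix.mul_apply, Zn, transpose_apply, Matrix.of_apply]
  refine Finset.sum_congr rfl fun y _ => ?_
  have : √(sampleProb s n y) * √(sampleProb s n y) = sampleProb s n y :=
    Real.mul_self_sqrt (by unfold sampleProb; positivity)
  linear_combination (-(sliceMean s n y).ofLp a * (sliceMean s n y).ofLp b) * this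

/-- The marginal coordinate statistic is the squared norm of `√n vec(α̂ᵀ ℤₙ)`. -/
theorem coordStat_eq_norm_sq {αx : Matrix (Fin p) (Fin r) ℝ} (hαx : αx.rank = r) :
    coordStat s n αx = ‖coordVector s n αx‖ ^ 2 := by
  by_cases hu : IsUnit (sampleCov s n)
  · have hpd : (sampleCov s n).PosDef := (sampleCov_posSemidef s n).posDef_iff_isUnit.2 hu
    have hortho := orthoBasis_transpose_mul_self hpd hαx
    set A := orthoBasis (sampleCov s n) αx with hA
    -- Right multiplication by the invertible (αₓᵀΣ̂⁻¹αₓ)^{-1/2} does not change the column span.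
    have hspan : hypSubspace (sampleCov s n) αx = colSpan A := by
      rw [hA, orthoBasis, colSpan_mul_of_isUnit _ (isUnit_invSqrt (posDef_conj_inv hpd hαx))]
      rfl
    have htr : (A * Aᵀ * (Zn s n * (Zn s n)ᵀ) * (A * Aᵀ)).trace
        = ((Aᵀ * Zn s n)ᵀ * (Aᵀ * Zn s n)).trace := by
      calc (A * Aᵀ * (Zn s n * (Zn s n)ᵀ) * (A * Aᵀ)).trace
          = ((A * Aᵀ) * (A * Aᵀ * (Zn s n * (Zn s n)ᵀ))).trace := trace_mul_comm _ _
        _ = ((A * (Aᵀ * A) * Aᵀ * Zn s n) * (Zn s n)ᵀ).trace := by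
          simp only [Matrix.mul_assoc]
        _ = ((Zn s n)ᵀ * (A * (Aᵀ * A) * Aᵀ * Zn s n)).trace := trace_mul_comm _ _
        _ = _ := by
          rw [hortho, Matrix.mul_one, transpose_mul, transpose_transpose]
          simp only [Matrix.mul_assoc]
    rw [coordStat, hspan, projMatrix_colSpan hortho, Mhat_eq, htr, EuclideanSpace.real_norm_sq_eq,
      Fintype.sum_prod_type, trace, Finset.mul_sum]
    refine Finset.sum_congr rfl fun y _ => ?_
    rw [diag_apply, Matrix.mul_apply, Finset.mul_sum]
    refine Finset.sum_congr rfl fun k _ => ?_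
    simp only [coordVector, ← hA, Pi.smul_apply, smul_eq_mul, vec, mul_pow,
      Real.sq_sqrt (Nat.cast_nonneg n), transpose_apply]
    ring
  -- For singular Σ̂ the estimated subspace and α̂ are both zero, so both sides vanish.
  · have h0 : invSqrt (sampleCov s n) = 0 := invSqrt_of_not_isUnit hu
    have hspan : hypSubspace (sampleCov s n) αx = ⊥ := by
      simp [hypSubspace, h0, colSpan]
    rw [coordStat, hspan, projMatrix_bot]
    simp [coordVector, orthoBasis, h0]

end Sample

end

/-! ### Moments of the summands and the form of Ω. -/

section LimitTheory

variable {p h r : ℕ} {ν : Measure (Obs p h)}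

lemma measurable_olsResid (y : Fin h) : Measurable fun z : Obs p h => olsResid ν z y := by
  have h1 := measurable_sliceInd (p := p) y
  unfold olsResid dotProduct
  refine (h1.sub_const _).sub (Finset.measurable_fun_sum _ fun l _ => ?_)
  simp only [WithLp.ofLp_sub, Pi.sub_apply]
  fun_prop

lemma measurable_scoreVec : Measurable (scoreVec ν) := by
  refine (WithLp.measurable_toLp 2 _).comp (measurable_pi_lambda _ fun a => ?_)
  refine (measurable_olsResid a.1).mul ?_
  rcases a.2 with _ | l
  · exact measurable_const
  · simp only [Option.elim, PiLp.sub_apply]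
    fun_prop

lemma popCov_apply_eq_integral (hmom : MemLp (fun z : Obs p h => z.1) 1 ν) (a b : Fin p) :
    popCov ν a b = ∫ z : Obs p h, (z.1 - popMean ν) a * (z.1 - popMean ν) b ∂ν := by
  rw [popCov, Matrix.of_apply, covariance, ← popMean_apply hmom, ← popMean_apply hmom]
  rfl

lemma Dg_inv (hslice : ∀ y, 0 < sliceProb ν y) :
    (Dg ν)⁻¹ = Matrix.diagonal fun y => (√(sliceProb ν y))⁻¹ := by
  refine inv_eq_right_inv ?_
  rw [Dg, diagonal_mul_diagonal, ← diagonal_one]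
  congr 1
  ext y
  exact mul_inv_cancel₀ (Real.sqrt_pos.2 (hslice y)).ne'

/-- The matrix `D_g⁻¹ ε εᵀ D_g⁻¹ ⊗ αᵀ Z Zᵀ α` is the outer square of a linear image of the
score vector. -/
lemma omegaIntegrand_eq (hcov : (popCov ν).PosDef) (hslice : ∀ y, 0 < sliceProb ν y)
    (αx : Matrix (Fin p) (Fin r) ℝ) (z : Obs p h) (a b : Fin h × Fin r) :
    omegaIntegrand ν αx z a b
      = (weightMatrix (sliceProb ν) (scoreMatrix (popCov ν) αx) 0 *ᵥ (scoreVec ν z).ofLp) a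
        * (weightMatrix (sliceProb ν) (scoreMatrix (popCov ν) αx) 0 *ᵥ (scoreVec ν z).ofLp) b := by
  have h1 : ∀ a : Fin h × Fin r,
      (weightMatrix (sliceProb ν) (scoreMatrix (popCov ν) αx) 0 *ᵥ (scoreVec ν z).ofLp) a
        = (√(sliceProb ν a.1))⁻¹ * olsResid ν z a.1
          * ((orthoBasis (popCov ν) αx)ᵀ *ᵥ (stdPred ν z).ofLp) a.2 := by
    intro a
    have h2 : (orthoBasis (popCov ν) αx)ᵀ *ᵥ (stdPred ν z).ofLp
        = scoreMatrix (popCov ν) αx *ᵥ (z.1 - popMean ν).ofLp := by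
      rw [← orthoBasis_transpose_mul_invSqrt hcov.posSemidef, ← mulVec_mulVec]
      rfl
    have h3 : (fun l => (scoreVec ν z).ofLp (a.1, some l))
        = olsResid ν z a.1 • (z.1 - popMean ν).ofLp := rfl
    rw [weightMatrix_mulVec_apply, h2, h3, mulVec_smul]
    simp [mul_assoc]
  rw [h1, h1, omegaIntegrand, Dg_inv hslice, kroneckerMap_apply, mul_diagonal,
    diagonal_mul, vecMulVec_apply, mul_vecMulVec, vecMulVec_mul, vecMulVec_apply, ← mulVec_transpose]
  ring

variable [IsProbabilityMeasure ν]

lemma memLp_olsResid (hmom : MemLp (fun z : Obs p h => z.1) 4 ν) (y : Fin h) :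
    MemLp (fun z => olsResid ν z y) 4 ν := by
  unfold olsResid dotProduct
  refine ((memLp_sliceInd y 4).sub (memLp_const _)).sub (memLp_finsetSum _ fun l _ => ?_)
  exact (memLp_apply (hmom.sub (memLp_const (popMean ν))) l).const_mul _

lemma holderTriple_four : ENNReal.HolderTriple 4 4 2 where
  inv_add_inv_eq_inv := by
    rw [← two_mul, show (4 : ENNReal) = 2 * 2 by norm_num,
      ENNReal.mul_inv (.inl two_ne_zero) (.inl ENNReal.ofNat_ne_top), ← mul_assoc,
      ENNReal.mul_inv_cancel two_ne_zero ENNReal.ofNat_ne_top, one_mul]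

/-- The fourth moments enter here: ε_y and X - EX lie in L⁴, so by Hölder their products lie in L².
-/
lemma memLp_scoreVec (hmom : MemLp (fun z : Obs p h => z.1) 4 ν) : MemLp (scoreVec ν) 2 ν := by
  refine MemLp.of_eval_piLp fun a => ?_
  have := holderTriple_four
  have h2 : MemLp (fun z : Obs p h =>
      a.2.elim (1 : ℝ) fun l => (z.1 - popMean ν) l) 4 ν := by
    rcases a.2 with _ | l
    · exact memLp_const 1
    · exact memLp_apply (hmom.sub (memLp_const (popMean ν))) l
  exact h2.mul' (memLp_olsResid hmom a.1)

lemma integral_sub_popMean_apply (hmom : MemLp (fun z : Obs p h => z.1) 1 ν) (l : Fin p) :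
    ∫ z : Obs p h, (z.1 - popMean ν) l ∂ν = 0 := by
  simp only [PiLp.sub_apply]
  rw [integral_sub ((memLp_apply hmom l).integrable le_rfl) (integrable_const _),
    ← popMean_apply hmom l]
  simp

/-- These are the normal equations of least squares: Σβ_y = Cov(X, J_y) makes ε_y uncorrelated with
X, and ε_y has mean zero by centring. -/
lemma integral_scoreVec (hmom : MemLp (fun z : Obs p h => z.1) 4 ν)
    (hcov : (popCov ν).PosDef) : ∫ z, scoreVec ν z ∂ν = 0 := by
  have hm2 : MemLp (fun z : Obs p h => z.1) 2 ν := hmom.mono_exponent (by norm_num)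
  have hm1 := hm2.mono_exponent one_le_two
  have hc2 : MemLp (fun z : Obs p h => z.1 - popMean ν) 2 ν := hm2.sub (memLp_const _)
  have hcl (l : Fin p) : MemLp (fun z : Obs p h => (z.1 - popMean ν) l) 2 ν := memLp_apply hc2 l
  have hb (y : Fin h) (l : Fin p) :
      Integrable (fun z : Obs p h => olsCoef ν y l * (z.1 - popMean ν) l) ν :=
    ((hcl l).integrable one_le_two).const_mul _
  ext a
  have hproj := (EuclideanSpace.proj (𝕜 := ℝ) a :
    EuclideanSpace ℝ (Fin h × Option (Fin p)) →L[ℝ] ℝ).integral_comp_comm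
      ((memLp_scoreVec hmom).integrable one_le_two)
  refine hproj.symm.trans ?_
  obtain ⟨y, _ | k⟩ := a
  · change ∫ z, olsResid ν z y * 1 ∂ν = 0
    simp only [mul_one, olsResid, dotProduct]
    have hs := (memLp_sliceInd (p := p) (ν := ν) y 1).integrable le_rfl
    have hs' : Integrable (fun z : Obs p h => sliceInd y z - sliceProb ν y) ν :=
      hs.sub (integrable_const _)
    rw [integral_sub hs' (integrable_finsetSum _ fun l _ => hb y l),
      integral_sub hs (integrable_const _), integral_sliceInd,
      integral_finsetSum _ fun l _ => hb y l]
    simp only [integral_const_mul, integral_sub_popMean_apply hm1]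
    simp
  · change ∫ z, olsResid ν z y * (z.1 - popMean ν) k ∂ν = 0
    have hpt : ∀ z : Obs p h, olsResid ν z y * (z.1 - popMean ν) k
        = (z.1 - popMean ν) k * sliceInd y z - sliceProb ν y * (z.1 - popMean ν) k
          - ∑ l, olsCoef ν y l * ((z.1 - popMean ν) k * (z.1 - popMean ν) l) := by
      intro z
      rw [olsResid, dotProduct, sub_mul, Finset.sum_mul, sub_mul, mul_comm (sliceInd y z)]
      congr 1
      exact Finset.sum_congr rfl fun l _ => by ring
    have h1 : Integrable (fun z : Obs p h => (z.1 - popMean ν) k * sliceInd y z) ν :=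
      (hcl k).integrable_mul (memLp_sliceInd y 2)
    have h2 : Integrable (fun z : Obs p h => sliceProb ν y * (z.1 - popMean ν) k) ν :=
      ((hcl k).integrable one_le_two).const_mul _
    have h3 (l : Fin p) : Integrable (fun z : Obs p h =>
        olsCoef ν y l * ((z.1 - popMean ν) k * (z.1 - popMean ν) l)) ν :=
      ((hcl k).integrable_mul (hcl l)).const_mul _
    have h12 : Integrable (fun z : Obs p h => (z.1 - popMean ν) k * sliceInd y z
        - sliceProb ν y * (z.1 - popMean ν) k) ν := h1.sub h2
    rw [integral_congr_ae (.of_forall hpt), integral_sub h12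
      (integrable_finsetSum _ fun l _ => h3 l), integral_sub h1 h2, ← cov_sliceInd hm2,
      integral_const_mul, integral_sub_popMean_apply hm1, integral_finsetSum _ fun l _ => h3 l]
    simp only [integral_const_mul, ← popCov_apply_eq_integral hm1]
    have h4 : (popCov ν *ᵥ olsCoef ν y) k = cov[fun z : Obs p h => z.1 k, sliceInd y; ν] := by
      rw [olsCoef, mulVec_mulVec, mul_nonsing_inv _ (isUnit_det_of_posDef hcov), one_mulVec]
    rw [← h4, mulVec, dotProduct, mul_zero, sub_zero, sub_eq_zero]
    exact Finset.sum_congr rfl fun l _ => mul_comm _ _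

end LimitTheory

/-! ### Almost sure convergence and measurability of the weights. -/

section LawOfLargeNumbers

variable {p h r : ℕ} {ν : Measure (Obs p h)} {Ω : Type*} [MeasurableSpace Ω] {P : Measure Ω}
  {s : ℕ → Ω → Obs p h}

lemma ae_tendsto_average (hindep : iIndepFun s P) (hlaw : ∀ i, HasLaw (s i) ν P)
    {φ : Obs p h → ℝ} (hφ : Measurable φ) (hint : Integrable φ ν) :
    ∀ᵐ ω ∂P, Tendsto (fun n : ℕ => (n : ℝ)⁻¹ * ∑ i ∈ Finset.range n, φ (s i ω)) atTop
      (𝓝 (∫ z, φ z ∂ν)) := by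
  have hident (i : ℕ) : IdentDistrib (s i) (s 0) P P :=
    ⟨(hlaw i).aemeasurable, (hlaw 0).aemeasurable, by rw [(hlaw i).map_eq, (hlaw 0).map_eq]⟩
  have h0 : Integrable (fun ω => φ (s 0 ω)) P := by
    have := (hlaw 0).map_eq ▸ hint
    exact this.comp_aemeasurable (hlaw 0).aemeasurable
  have := strong_law_ae (μ := P) (fun i ω => φ (s i ω)) h0
    (fun i j hij => (hindep.indepFun hij).comp hφ hφ) (fun i => (hident i).comp hφ)
  rwa [show ∫ ω, φ (s 0 ω) ∂P = ∫ z, φ z ∂ν from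
    (hlaw 0).integral_comp hφ.aestronglyMeasurable] at this

lemma sampleProb_eq (x : ℕ → Obs p h) (n : ℕ) (y : Fin h) :
    sampleProb x n y = (n : ℝ)⁻¹ * ∑ i ∈ Finset.range n, sliceInd y (x i) := by
  simp [sampleProb, sliceCount, sliceInd, div_eq_inv_mul]

lemma sampleMean_apply (x : ℕ → Obs p h) (n : ℕ) (l : Fin p) :
    sampleMean x n l = (n : ℝ)⁻¹ * ∑ i ∈ Finset.range n, (x i).1 l := by
  simp [sampleMean]

/-- Averages of functions of single observations are what the strong law needs; the same form gives
measurability. -/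
lemma sampleCov_apply (x : ℕ → Obs p h) (n : ℕ) (a b : Fin p) :
    sampleCov x n a b = (n : ℝ)⁻¹ * ∑ i ∈ Finset.range n, (x i).1 a * (x i).1 b
      - sampleMean x n a * sampleMean x n b := by
  rcases Nat.eq_zero_or_pos n with rfl | hn
  · simp [sampleCov, sampleMean]
  have hn' : (n : ℝ) ≠ 0 := by positivity
  have hsum : ∀ l, ∑ i ∈ Finset.range n, (x i).1 l = n * sampleMean x n l := fun l => by
    rw [sampleMean_apply, mul_inv_cancel_left₀ hn']
  simp only [sampleCov, Matrix.smul_apply, Matrix.sum_apply, vecMulVec_apply, WithLp.ofLp_sub,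
    Pi.sub_apply, smul_eq_mul, sub_mul, mul_sub, Finset.sum_sub_distrib, ← Finset.sum_mul,
    ← Finset.mul_sum, hsum, Finset.sum_const, Finset.card_range, nsmul_eq_mul]
  field_simp
  ring

lemma ae_tendsto_sampleMean [IsProbabilityMeasure ν] (hindep : iIndepFun s P)
    (hlaw : ∀ i, HasLaw (s i) ν P) (hmom : MemLp (fun z : Obs p h => z.1) 1 ν) (l : Fin p) :
    ∀ᵐ ω ∂P, Tendsto (fun n => sampleMean (fun i => s i ω) n l) atTop (𝓝 (popMean ν l)) := by
  filter_upwards [ae_tendsto_average hindep hlaw (φ := fun z => z.1 l) (by fun_prop)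
    ((memLp_apply hmom l).integrable le_rfl)] with ω hω
  simpa only [sampleMean_apply, popMean_apply hmom l] using hω

lemma ae_tendsto_sampleCov [IsProbabilityMeasure ν] (hindep : iIndepFun s P)
    (hlaw : ∀ i, HasLaw (s i) ν P) (hmom : MemLp (fun z : Obs p h => z.1) 2 ν) :
    ∀ᵐ ω ∂P, Tendsto (fun n => sampleCov (fun i => s i ω) n) atTop (𝓝 (popCov ν)) := by
  have hm1 := hmom.mono_exponent one_le_two
  have h1 : ∀ᵐ ω ∂P, ∀ l, Tendsto (fun n => sampleMean (fun i => s i ω) n l) atTop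
      (𝓝 (popMean ν l)) := ae_all_iff.2 fun l => ae_tendsto_sampleMean hindep hlaw hm1 l
  have h2 : ∀ᵐ ω ∂P, ∀ a b, Tendsto (fun n : ℕ => (n : ℝ)⁻¹ *
      ∑ i ∈ Finset.range n, (s i ω).1 a * (s i ω).1 b) atTop
      (𝓝 (∫ z : Obs p h, z.1 a * z.1 b ∂ν)) :=
    ae_all_iff.2 fun a => ae_all_iff.2 fun b =>
      ae_tendsto_average hindep hlaw (φ := fun z => z.1 a * z.1 b) (by fun_prop)
        ((memLp_apply hmom a).integrable_mul (memLp_apply hmom b))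
  filter_upwards [h1, h2] with ω h1 h2
  refine tendsto_pi_nhds.2 fun a => tendsto_pi_nhds.2 fun b => ?_
  have h3 : popCov ν a b = ∫ z : Obs p h, z.1 a * z.1 b ∂ν - popMean ν a * popMean ν b := by
    rw [popCov, Matrix.of_apply, covariance_eq_sub (memLp_apply hmom a) (memLp_apply hmom b),
      popMean_apply hm1, popMean_apply hm1]
    rfl
  simp only [sampleCov_apply, h3]
  exact (h2 a b).sub ((h1 a).mul (h1 b))

lemma ae_tendsto_sampleProb [IsProbabilityMeasure ν] (hindep : iIndepFun s P)
    (hlaw : ∀ i, HasLaw (s i) ν P) (y : Fin h) :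
    ∀ᵐ ω ∂P, Tendsto (fun n => sampleProb (fun i => s i ω) n y) atTop
      (𝓝 (sliceProb ν y)) := by
  filter_upwards [ae_tendsto_average hindep hlaw (measurable_sliceInd y)
    ((memLp_sliceInd y 1).integrable le_rfl)] with ω hω
  simpa only [sampleProb_eq, integral_sliceInd] using hω

lemma tendsto_weightMatrix {α : Type*} {l : Filter α} {f : α → Fin h → ℝ} {f₀ : Fin h → ℝ}
    {B : α → Matrix (Fin r) (Fin p) ℝ} {B₀ : Matrix (Fin r) (Fin p) ℝ} {d : α → Fin p → ℝ}
    {d₀ : Fin p → ℝ} (hf : Tendsto f l (𝓝 f₀)) (hf₀ : ∀ y, 0 < f₀ y) (hB : Tendsto B l (𝓝 B₀))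
    (hd : Tendsto d l (𝓝 d₀)) :
    Tendsto (fun i => weightMatrix (f i) (B i) (d i)) l (𝓝 (weightMatrix f₀ B₀ d₀)) := by
  refine tendsto_pi_nhds.2 fun a => tendsto_pi_nhds.2 fun b => ?_
  simp only [weightMatrix, kroneckerMap_apply, Matrix.of_apply]
  have hBe (k : Fin r) (j : Fin p) : Tendsto (fun i => B i k j) l (𝓝 (B₀ k j)) :=
    (tendsto_pi_nhds.1 (tendsto_pi_nhds.1 hB k)) j
  refine Tendsto.mul ?_ ?_
  · simp only [Matrix.diagonal_apply]
    split_ifs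
    · exact ((tendsto_pi_nhds.1 hf a.1).sqrt).inv₀ (Real.sqrt_pos.2 (hf₀ a.1)).ne'
    · exact tendsto_const_nhds
  · rcases b.2 with _ | j
    · simp only [Option.elim, mulVec, dotProduct]
      exact (tendsto_finsetSum _ fun j _ => (hBe a.2 j).mul (tendsto_pi_nhds.1 hd j)).neg
    · exact hBe a.2 j

lemma measurable_weightMatrix_apply {α : Type*} [MeasurableSpace α] {f : α → Fin h → ℝ}
    {B : α → Matrix (Fin r) (Fin p) ℝ} {d : α → Fin p → ℝ} (hf : ∀ y, Measurable fun x => f x y)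
    (hB : ∀ k j, Measurable fun x => B x k j) (hd : ∀ j, Measurable fun x => d x j)
    (a : Fin h × Fin r) (b : Fin h × Option (Fin p)) :
    Measurable fun x => weightMatrix (f x) (B x) (d x) a b := by
  simp only [weightMatrix, kroneckerMap_apply, Matrix.of_apply]
  refine Measurable.mul ?_ ?_
  · simp only [Matrix.diagonal_apply]
    split_ifs
    · exact (hf a.1).sqrt.inv
    · exact measurable_const
  · rcases b.2 with _ | j
    · simp only [Option.elim, mulVec, dotProduct]
      exact (Finset.measurable_fun_sum _ fun j _ => (hB a.2 j).mul (hd j)).neg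
    · exact hB a.2 j

lemma measurable_sampleMean_apply (n : ℕ) (l : Fin p) :
    Measurable fun x : ℕ → Obs p h => sampleMean x n l := by
  simp only [sampleMean_apply]
  fun_prop

lemma measurable_sampleCov_apply (n : ℕ) (a b : Fin p) :
    Measurable fun x : ℕ → Obs p h => sampleCov x n a b := by
  have := measurable_sampleMean_apply (p := p) (h := h) n
  simp only [sampleCov_apply]
  fun_prop

lemma measurable_sampleProb (n : ℕ) (y : Fin h) :
    Measurable fun x : ℕ → Obs p h => sampleProb x n y := by
  have := measurable_sliceInd (p := p) y
  simp only [sampleProb_eq]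
  fun_prop

/-- Measurability is proved on the space of sequences, to be pulled back along the almost everywhere
measurable sample. -/
lemma measurable_sampleWeight_apply (ν : Measure (Obs p h)) (αx : Matrix (Fin p) (Fin r) ℝ) (n : ℕ)
    (a : Fin h × Fin r) (b : Fin h × Option (Fin p)) :
    Measurable fun x : ℕ → Obs p h => weightMatrix (sampleProb x n)
      (scoreMatrix (sampleCov x n) αx) (sampleMean x n - popMean ν).ofLp a b :=
  measurable_weightMatrix_apply (measurable_sampleProb n)
    (measurable_scoreMatrix_apply (measurable_sampleCov_apply n) αx)
    (fun l => (measurable_sampleMean_apply n l).sub_const _) a b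

end LawOfLargeNumbers

end CoordTest

/-! ### The limit theorem. -/

open CoordTest
theorem theorem1 {p h r : ℕ}
    -- the joint distribution of `(X, Y)`
    (ν : Measure (Obs p h)) [IsProbabilityMeasure ν]
    (hmom : MemLp (fun z : Obs p h => z.1) 4 ν)
    (hcov : (popCov ν).PosDef)
    (hslice : ∀ y, 0 < sliceProb ν y)
    (hcentral : CentralSubspaceExists ν)
    (αx : Matrix (Fin p) (Fin r) ℝ) (hαx : αx.rank = r)
    -- the i.i.d. sample
    {Ω : Type*} [MeasurableSpace Ω] (P : Measure Ω) [IsProbabilityMeasure P]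
    (s : ℕ → Ω → Obs p h)
    (hindep : iIndepFun s P) (hlaw : ∀ i, HasLaw (s i) ν P)
    -- the linearity condition and the coordinate hypothesis
    (hlin : LinearityCondition ν) (hcoord : CoordinateHypothesis ν αx) :
    (∀ a b, Integrable (fun z => omegaIntegrand ν αx z a b) ν) ∧
    ∃ hΩ : (omegaH ν αx).PosSemidef,
      TendstoInDistribution (fun (n : ℕ) ω => coordVector (fun i => s i ω) n αx) atTop id
        (fun _ => P) (multivariateGaussian 0 (omegaH ν αx)) ∧
      TendstoInDistribution (fun (n : ℕ) ω => coordStat (fun i => s i ω) n αx) atTop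
        (fun w : Fin h × Fin r → ℝ => ∑ i, hΩ.isHermitian.eigenvalues i * w i)
        (fun _ => P) (Measure.pi fun _ => chiSqOne) := by
  have hm2 : MemLp (fun z : Obs p h => z.1) 2 ν := hmom.mono_exponent (by norm_num)
  have hm1 := hm2.mono_exponent one_le_two
  have hβ := transpose_mulVec_olsCoef_eq_zero hm2 hcov hcentral hlin hcoord
  -- The almost sure limit of the weights, with last argument 0 because the sample mean converges to
  -- EX.
  set A := weightMatrix (sliceProb ν) (scoreMatrix (popCov ν) αx) 0 with hA
  have hscore := memLp_scoreVec hmom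
  have himage : MemLp (fun z => (WithLp.toLp 2 (A *ᵥ (scoreVec ν z).ofLp) :
      EuclideanSpace ℝ (Fin h × Fin r))) 2 ν :=
    (Matrix.toEuclideanLin A).toContinuousLinearMap.comp_memLp' hscore
  have hint : ∀ a b, Integrable (fun z => omegaIntegrand ν αx z a b) ν := fun a b => by
    simp only [omegaIntegrand_eq hcov hslice]
    exact (memLp_apply himage a).integrable_mul (memLp_apply himage b)
  -- Ω is the second moment matrix of A applied to the score vector, which yields both its positive
  -- semidefiniteness and the covariance of the limit.
  have hΩentry : ∀ a b, omegaH ν αx a b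
      = ∫ z, (A *ᵥ (scoreVec ν z).ofLp) a * (A *ᵥ (scoreVec ν z).ofLp) b ∂ν := fun a b => by
    simp only [omegaH, Matrix.of_apply, omegaIntegrand_eq hcov hslice, hA]
  have hΩ : (omegaH ν αx).PosSemidef := posSemidef_of_eq_integral himage hΩentry
  have hident (i : ℕ) : IdentDistrib (s i) (s 0) P P :=
    ⟨(hlaw i).aemeasurable, (hlaw 0).aemeasurable, by rw [(hlaw i).map_eq, (hlaw 0).map_eq]⟩
  have hsample : AEMeasurable (fun ω i => s i ω) P :=
    aemeasurable_pi_iff.2 fun i => (hlaw i).aemeasurable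
  have hconv : ∀ᵐ ω ∂P, Tendsto (fun n => weightMatrix (sampleProb (fun i => s i ω) n)
      (scoreMatrix (sampleCov (fun i => s i ω) n) αx)
      (sampleMean (fun i => s i ω) n - popMean ν).ofLp) atTop (𝓝 A) := by
    filter_upwards [ae_tendsto_sampleCov hindep hlaw hm2,
      ae_all_iff.2 fun l => ae_tendsto_sampleMean hindep hlaw hm1 l,
      ae_all_iff.2 fun y => ae_tendsto_sampleProb hindep hlaw y] with ω h1 h2 h3
    refine tendsto_weightMatrix (tendsto_pi_nhds.2 h3) hslice
      (tendsto_scoreMatrix hcov (fun n => sampleCov_posSemidef _ n) h1 hαx)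
      (tendsto_pi_nhds.2 fun l => ?_)
    simpa using (h2 l).sub_const (popMean ν l)
  have hmain : TendstoInDistribution (fun (n : ℕ) ω => coordVector (fun i => s i ω) n αx) atTop id
      (fun _ => P) (multivariateGaussian 0 (omegaH ν αx)) := by
    simp only [coordVector_eq _ _ ν hβ]
    refine tendstoInDistribution_mulVec_inv_sqrt_smul_sum
      (X := fun i ω => scoreVec ν (s i ω)) (A := A) ?_ ?_
      (hindep.comp (fun _ => scoreVec ν) fun _ => measurable_scoreVec)
      (fun i => (hident i).comp measurable_scoreVec)
      (fun n a b => (measurable_sampleWeight_apply ν αx n a b).comp_aemeasurable hsample)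
      hconv fun a b => ?_
    · have hmap : MemLp (scoreVec ν) 2 (P.map (s 0)) := by rwa [(hlaw 0).map_eq]
      exact hmap.comp_of_map (hlaw 0).aemeasurable
    · exact ((hlaw 0).integral_comp measurable_scoreVec.aestronglyMeasurable).trans
        (integral_scoreVec hmom hcov)
    · rw [hΩentry]
      refine ((hlaw 0).integral_comp
        (f := fun z => (A *ᵥ (scoreVec ν z).ofLp) a * (A *ᵥ (scoreVec ν z).ofLp) b) ?_).symm
      exact ((memLp_apply himage a).integrable_mul (memLp_apply himage b)).aestronglyMeasurable
  refine ⟨hint, hΩ, hmain, ?_⟩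
  simp only [coordStat_eq_norm_sq _ _ hαx]
  exact tendstoInDistribution_norm_sq_of_multivariateGaussian hΩ hmain
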